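/- **Setting.** Let $w_0:[0,\infty)\to[0,\infty)$ be decreasing and integrable, let $\|X\|_\infty=\sup\{x\ge 0: w_0(x)>0\}\in(0,\infty]$ be the end of its support, and assume that $h(x)=\int_x^\infty w_0(x')\,dx'$ is $C^2$ on $[0,\|X\|_\infty)$. The beta function of $w_0$ is $\beta_0(x)=h''(x)h(x)/h'(x)^2$, $0\le x<\|X\|_\infty$. Let $w(x,t)$, $x,t\ge 0$, be a solution of the Lifschitz–Slyozov–Wagner (LSW) system $$\frac{\partial w}{\partial t}(x,t)=\Big[1-\Big(\frac{x}{L(t)}\Big)^{1/3}\Big]\frac{\partial w}{\partial x}(x,t)\quad (x,t>0),\qquad \int_0^\infty w(x,t)\,dx=1\quad (t\ge 0),$$ with $w(\cdot,0)=w_0$ and $$L(t)^{1/3}=\frac13\int_0^\infty x^{-2/3}w(x,t)\,dx\Big/w(0,t),$$ normalized by $L(0)=1$. Here $w$ is continuous on $[0,\infty)^2$, $w(\cdot,t)$ is nonnegative and decreasing, and the differential equation holds classically wherever $w>0$. Let $c=-\partial w/\partial x$, and let $$\Lambda(t)=\int_0^\infty x\,c(x,t)\,dx\Big/\int_0^\infty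 c(x,t)\,dx$$ be the mean cluster volume. **Proposition 5.2.** Suppose that $\sup\beta_0<\infty$ and that $\lim_{x\to\|X\|_\infty}\beta_0(x)$ exists (as a finite number) and is positive. Then $$\Lambda(T)\ \ge\ C\,T\qquad\text{for all } T\ge 1,$$ for some constant $C>0$ depending only on the function $\beta_0:[0,\|X\|_\infty)\to\mathbb R$. -/

import Mathlib

open Set Filter Topology MeasureTheory

noncomputable section

namespace LSW

/-- The right end `‖X‖_∞ ∈ [0, ∞]` of the support of a decreasing function `w ≥ 0` on `[0, ∞)`;
`X` is the random variable with `P(X > x) = w x / w 0`. -/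
def supportEnd (w : ℝ → ℝ) : EReal :=
  sSup ((fun x : ℝ => (x : EReal)) '' {x : ℝ | 0 ≤ x ∧ 0 < w x})

/-- The interval `[0, a)` of reals, where `a` may be `+∞`. -/
def domainUpTo (a : EReal) : Set ℝ := {x : ℝ | 0 ≤ x ∧ (x : EReal) < a}

/-- The filter "`x → a`, `x < a`" on the real line, where `a` may be `+∞`. -/
def towardsEnd (a : EReal) : Filter ℝ := comap (fun x : ℝ => (x : EReal)) (𝓝[<] a)

/-- `h x = ∫_x^∞ w`. -/
def tailIntegral (w : ℝ → ℝ) (x : ℝ) : ℝ := ∫ y in Ioi x, w y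

/-- The beta function `β = h'' h / (h')²` of `w`, for `h x = ∫_x^∞ w`. Derivatives are relative to
`[0, ∞)`, so they are one-sided at `0`. Meaningful on `[0, ‖X‖_∞)` when `h` is `C²` there. -/
def betaFun (w : ℝ → ℝ) (x : ℝ) : ℝ :=
  iteratedDerivWithin 2 (tailIntegral w) (Ici 0) x * tailIntegral w x /
    (derivWithin (tailIntegral w) (Ici 0) x) ^ 2

/-- Initial data: a nonnegative decreasing integrable function on `[0, ∞)` for which
`h x = ∫_x^∞ w₀` is `C²` on `[0, ‖X‖_∞)`, so that its beta function is defined. -/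
structure IsInitialDatum (w₀ : ℝ → ℝ) : Prop where
  nonneg : ∀ x, 0 ≤ x → 0 ≤ w₀ x
  antitone : AntitoneOn w₀ (Ici 0)
  integrable : IntegrableOn w₀ (Ioi 0)
  contDiff : ContDiffOn ℝ 2 (tailIntegral w₀) (domainUpTo (supportEnd w₀))

/-- The parameter `L` of a profile `u`, given by `L^{1/3} = (1/3) ∫_0^∞ x^{-2/3} u(x) dx / u(0)`. -/
def paramL (u : ℝ → ℝ) : ℝ :=
  ((1 / 3) * (∫ x in Ioi (0 : ℝ), x ^ (-(2 / 3) : ℝ) * u x) / u 0) ^ 3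

/-- `w x t`, `x ≥ 0`, `t ≥ 0`, is a solution with initial data `w₀` of the LSW system
`∂w/∂t = [1 - (x / L(t))^{1/3}] ∂w/∂x` for `x, t > 0`, and `∫_0^∞ w(x,t) dx = 1`,
where `L(t)` is the parameter of `w(·,t)`.

As usual, `w(·,t)` is nonnegative and decreasing (it is the tail integral of a density `c ≥ 0`).
The solution is continuous up to the boundary, and differentiable with the equation holding at
all points where `w > 0`. Where `w = 0` the equation carries no further information: `w` vanishes
identically beyond the end of its support, while at the moving end of the support itself `w` need
not be differentiable (already `w₀` need not be differentiable at the end of its support). -/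
structure IsSolution (w₀ : ℝ → ℝ) (w : ℝ → ℝ → ℝ) : Prop where
  initial : ∀ x, 0 ≤ x → w x 0 = w₀ x
  continuousOn : ContinuousOn (Function.uncurry w) (Ici 0 ×ˢ Ici 0)
  nonneg : ∀ x t, 0 ≤ x → 0 ≤ t → 0 ≤ w x t
  antitone : ∀ t, 0 ≤ t → AntitoneOn (fun x => w x t) (Ici 0)
  differentiableAt : ∀ x t, 0 < x → 0 < t → 0 < w x t →
    DifferentiableAt ℝ (Function.uncurry w) (x, t)
  equation : ∀ x t, 0 < x → 0 < t → 0 < w x t →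
    deriv (fun s => w x s) t =
      (1 - (x / paramL (fun y => w y t)) ^ (1 / 3 : ℝ)) * deriv (fun y => w y t) x
  integrable : ∀ t, 0 ≤ t → IntegrableOn (fun x => w x t) (Ioi 0)
  conservation : ∀ t, 0 ≤ t → ∫ x in Ioi (0 : ℝ), w x t = 1

/-- The density `c = -∂w/∂x` of clusters of volume `x` at time `t`. -/
def density (w : ℝ → ℝ → ℝ) (x t : ℝ) : ℝ := -deriv (fun y => w y t) x

/-- The mean cluster volume `Λ(t) = ∫_0^∞ x c(x,t) dx / ∫_0^∞ c(x,t) dx`. -/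
def meanVolume (w : ℝ → ℝ → ℝ) (t : ℝ) : ℝ :=
  (∫ x in Ioi (0 : ℝ), x * density w x t) / (∫ x in Ioi (0 : ℝ), density w x t)

end LSW

end

/-!
Write `N t = w(0, t)`, so that the mean volume is `Λ = 1 / N`, a nondecreasing function of time.
The solution is transported by the characteristics `X' = (X / L)^{1/3} - 1`. Let `z t` be the initial
volume of the clusters which vanish at time `t`; then `w₀ (z t) = N t`. The mean residual volume
`m = h / w₀` of the initial datum satisfies `m' = β₀ - 1` and `w₀' = -β₀ w₀ / m`. Hence, where
`β₀` is bounded below, an increase of the label `z` by `ε m(z)` increases `Λ` by a definite factor,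
and it suffices to show that such an increase happens regularly on the time scale `Λ`.

*Concentration.* The gap between two characteristics grows at the rate
`1 / ((a² + a b + b²) L^{1/3})`, where `a`, `b` are the cube roots of their volumes. This rate
decreases in `a` and `b`, so the map from volumes to initial volumes is convex. Together with
`∫ w = 1` this bounds the fraction of clusters above `Λ / 4` from below
(`IsEvolution.fracB_mul_le`), and `L` and `Λ` are comparable (`IsEvolution.ratioB_mul_le`,
`IsUnitProfile.paramL_le`).

*Recurrence.* Time is divided into windows `[t_k, t_k + Λ(t_k) / 4]`. A window is fast if the label
increases in it by at least `ε m`; the first one is fast. The rates also satisfy an inequality for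
four characteristics (`rate_cross_le`), by which a cross-ratio of volumes is monotone in time
(`IsChar.cross_ratio`). If a fast window were followed by a long run of slow ones, then `Λ` would
hardly change in the run, and characteristics which vanish well within the run would approach,
backwards in time, those which barely survive it, at an exponential rate. The cross-ratio would
then be too small for labels which hardly move during the run but have moved before it
(`IsEvolution.exists_fast`). So fast windows recur within a bounded number of windows.

*Growth.* The label passes the point beyond which `β₀` is bounded below after boundedly many
windows, as `m` is bounded below before that point. From then on `Λ` grows geometrically in the
number of windows, and the time is a geometric sum dominated by its last term (`exists_growth`).

*Dependence of the constant.* The lower bound for `m` is a function of `β₀` alone, because `β₀`, unit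
mass and `L(0) = 1` determine `m`: two candidates differ by a constant, the larger one belongs to
the more slowly decaying datum, and `L(0) = 1` excludes strict comparison (`HasBeta.resid_eq`).
-/

noncomputable section

namespace LSW

/-! ### Decreasing profiles of unit mass -/

/-- A nonnegative decreasing profile on `[0, ∞)` of total mass one: the properties of `w(·, t)` at
a fixed time. -/
structure IsUnitProfile (u : ℝ → ℝ) : Prop where
  nonneg : ∀ x, 0 ≤ x → 0 ≤ u x
  antitone : AntitoneOn u (Ici 0)
  integrable : IntegrableOn u (Ioi 0)
  mass : ∫ x in Ioi (0 : ℝ), u x = 1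

namespace IsUnitProfile

variable {u : ℝ → ℝ}

lemma exists_pos (hu : IsUnitProfile u) : ∃ x, 0 < x ∧ 0 < u x := by
  by_contra! h
  have : ∫ x in Ioi (0 : ℝ), u x = 0 := by
    refine setIntegral_eq_zero_of_forall_eq_zero fun x hx => ?_
    exact le_antisymm (h x hx) (hu.nonneg x (le_of_lt hx))
  linarith [hu.mass]

lemma zero_pos (hu : IsUnitProfile u) : 0 < u 0 := by
  obtain ⟨x, hx, hux⟩ := hu.exists_pos
  exact hux.trans_le (hu.antitone (mem_Ici.2 le_rfl) hx.le hx.le)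

lemma mul_le_one (hu : IsUnitProfile u) {x : ℝ} (hx : 0 ≤ x) : x * u x ≤ 1 := by
  have h1 : ∫ y in Ioc 0 x, u x ≤ ∫ y in Ioc 0 x, u y := by
    refine setIntegral_mono_on (by simp) (hu.integrable.mono_set Ioc_subset_Ioi_self)
      measurableSet_Ioc fun y hy => ?_
    exact hu.antitone (mem_Ici.2 hy.1.le) (mem_Ici.2 hx) hy.2
  have h2 : ∫ y in Ioc 0 x, u y ≤ ∫ y in Ioi 0, u y := by
    refine setIntegral_mono_set hu.integrable ?_ (Ioc_subset_Ioi_self.eventuallyLE)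
    filter_upwards [self_mem_ae_restrict measurableSet_Ioi] with y hy
    exact hu.nonneg y (le_of_lt hy)
  have h3 : ∫ y in Ioc 0 x, u x = x * u x := by simp [hx]
  linarith [hu.mass]

end IsUnitProfile

/-- The majorant `x^{-2/3} min (M, 1/x)` of `x^{-2/3} u x`, valid for every unit profile `u` with
`u 0 ≤ M`. -/
def singularBound (M x : ℝ) : ℝ := if x ≤ 1 then M * x ^ (-(2 / 3) : ℝ) else x ^ (-(5 / 3) : ℝ)

lemma integrableOn_singularBound (M : ℝ) : IntegrableOn (singularBound M) (Ioi 0) := by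
  rw [← Ioc_union_Ioi_eq_Ioi (zero_le_one' ℝ)]
  refine IntegrableOn.union ?_ ?_
  · have : IntegrableOn (fun x : ℝ => M * x ^ (-(2 / 3) : ℝ)) (Ioc 0 1) := by
      have h := intervalIntegral.intervalIntegrable_rpow' (a := 0) (b := 1)
        (r := (-(2 / 3) : ℝ)) (by norm_num)
      rw [intervalIntegrable_iff_integrableOn_Ioc_of_le zero_le_one] at h
      exact h.const_mul M
    refine this.congr_fun (fun x hx => ?_) measurableSet_Ioc
    simp [singularBound, hx.2]
  · have : IntegrableOn (fun x : ℝ => x ^ (-(5 / 3) : ℝ)) (Ioi 1) :=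
      integrableOn_Ioi_rpow_of_lt (by norm_num) one_pos
    refine this.congr_fun (fun x hx => ?_) measurableSet_Ioi
    simp [singularBound, not_le.2 (mem_Ioi.1 hx)]

namespace IsUnitProfile

variable {u : ℝ → ℝ}

lemma singular_le (hu : IsUnitProfile u) {M x : ℝ} (hM : u 0 ≤ M) (hx : 0 < x) :
    ‖x ^ (-(2 / 3) : ℝ) * u x‖ ≤ singularBound M x := by
  have hp : 0 < x ^ (-(2 / 3) : ℝ) := Real.rpow_pos_of_pos hx _
  rw [Real.norm_of_nonneg (mul_nonneg hp.le (hu.nonneg x hx.le)), singularBound]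
  split_ifs with h
  · rw [mul_comm]
    exact mul_le_mul_of_nonneg_right ((hu.antitone (mem_Ici.2 le_rfl) hx.le hx.le).trans hM) hp.le
  · have h1 : u x ≤ x⁻¹ := by
      rw [← one_div, le_div_iff₀ hx, mul_comm]; exact hu.mul_le_one hx.le
    calc x ^ (-(2 / 3) : ℝ) * u x ≤ x ^ (-(2 / 3) : ℝ) * x⁻¹ :=
          mul_le_mul_of_nonneg_left h1 hp.le
      _ = x ^ (-(5 / 3) : ℝ) := by
          rw [← Real.rpow_neg_one x, ← Real.rpow_add hx]; norm_num

lemma aestronglyMeasurable_singular (hu : IsUnitProfile u) :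
    AEStronglyMeasurable (fun x : ℝ => x ^ (-(2 / 3) : ℝ) * u x) (volume.restrict (Ioi 0)) := by
  refine AEStronglyMeasurable.mul ?_ hu.integrable.aestronglyMeasurable
  exact (measurable_id.pow_const _).aestronglyMeasurable

lemma integrable_singular (hu : IsUnitProfile u) :
    IntegrableOn (fun x : ℝ => x ^ (-(2 / 3) : ℝ) * u x) (Ioi 0) := by
  refine (integrableOn_singularBound (u 0)).mono' hu.aestronglyMeasurable_singular ?_
  filter_upwards [self_mem_ae_restrict measurableSet_Ioi] with x hx
  exact hu.singular_le le_rfl hx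

end IsUnitProfile

/-- The cube root of the parameter `L` of a profile. -/
def rootL (u : ℝ → ℝ) : ℝ := (1 / 3) * (∫ x in Ioi (0 : ℝ), x ^ (-(2 / 3) : ℝ) * u x) / u 0

lemma paramL_eq (u : ℝ → ℝ) : paramL u = rootL u ^ 3 := rfl

lemma integral_rpow_neg_two_thirds {X : ℝ} (hX : 0 ≤ X) :
    ∫ x in Ioc 0 X, x ^ (-(2 / 3) : ℝ) = 3 * X ^ (1 / 3 : ℝ) := by
  rw [← intervalIntegral.integral_of_le hX, integral_rpow (Or.inl (by norm_num))]
  rw [show (-(2 / 3) : ℝ) + 1 = 1 / 3 by norm_num, Real.zero_rpow (by norm_num)]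
  ring

lemma integrableOn_rpow_neg_two_thirds {X : ℝ} (hX : 0 ≤ X) :
    IntegrableOn (fun x : ℝ => x ^ (-(2 / 3) : ℝ)) (Ioc 0 X) := by
  rw [← intervalIntegrable_iff_integrableOn_Ioc_of_le hX]
  exact intervalIntegral.intervalIntegrable_rpow' (by norm_num)

namespace IsUnitProfile

variable {u : ℝ → ℝ}

lemma singular_nonneg_ae (hu : IsUnitProfile u) :
    0 ≤ᵐ[volume.restrict (Ioi 0)] fun x : ℝ => x ^ (-(2 / 3) : ℝ) * u x := by
  filter_upwards [self_mem_ae_restrict measurableSet_Ioi] with x hx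
  exact mul_nonneg (Real.rpow_nonneg (le_of_lt hx) _) (hu.nonneg x (le_of_lt hx))

/-- A lower bound for `L` when a fixed fraction of the clusters has volume at least `X`. -/
lemma le_rootL (hu : IsUnitProfile u) {X κ : ℝ} (hX : 0 ≤ X) (h : κ * u 0 ≤ u X) :
    κ * X ^ (1 / 3 : ℝ) ≤ rootL u := by
  have h1 : ∫ x in Ioc 0 X, x ^ (-(2 / 3) : ℝ) * u X ≤ ∫ x in Ioc 0 X, x ^ (-(2 / 3) : ℝ) * u x := by
    refine setIntegral_mono_on ((integrableOn_rpow_neg_two_thirds hX).mul_const _)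
      (hu.integrable_singular.mono_set Ioc_subset_Ioi_self) measurableSet_Ioc fun x hx => ?_
    exact mul_le_mul_of_nonneg_left (hu.antitone (mem_Ici.2 hx.1.le) (mem_Ici.2 hX) hx.2)
      (Real.rpow_nonneg hx.1.le _)
  have h2 : ∫ x in Ioc 0 X, x ^ (-(2 / 3) : ℝ) * u x ≤ ∫ x in Ioi 0, x ^ (-(2 / 3) : ℝ) * u x :=
    setIntegral_mono_set hu.integrable_singular hu.singular_nonneg_ae
      (Ioc_subset_Ioi_self.eventuallyLE)
  rw [integral_mul_const, integral_rpow_neg_two_thirds hX] at h1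
  have h0 := hu.zero_pos
  rw [rootL, le_div_iff₀ h0]
  have h3 : 0 ≤ X ^ (1 / 3 : ℝ) := Real.rpow_nonneg hX _
  nlinarith [mul_le_mul_of_nonneg_left h h3]

lemma rootL_pos (hu : IsUnitProfile u) : 0 < rootL u := by
  obtain ⟨x, hx, hux⟩ := hu.exists_pos
  have h0 := hu.zero_pos
  refine lt_of_lt_of_le ?_ (hu.le_rootL (κ := u x / u 0) hx.le (by field_simp; rfl))
  have := Real.rpow_pos_of_pos hx (1 / 3 : ℝ)
  positivity

lemma paramL_pos (hu : IsUnitProfile u) : 0 < paramL u := by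
  rw [paramL_eq]; exact pow_pos hu.rootL_pos 3

/-- `L` is at most the mean volume `1 / u 0`. The weight `x^{-2/3} - Λ^{-2/3}` changes sign at
`Λ = 1 / u 0`, so among profiles of given mass and bounded by `u 0` the integral is largest for
the indicator of `[0, Λ]`. -/
lemma rootL_le (hu : IsUnitProfile u) : rootL u ≤ (1 / u 0) ^ (1 / 3 : ℝ) := by
  have h0 := hu.zero_pos
  set Λ := 1 / u 0 with hΛ
  have hΛ0 : 0 < Λ := by positivity
  set p := Λ ^ (-(2 / 3) : ℝ) with hp
  set r := Λ ^ (1 / 3 : ℝ) with hr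
  have hpr : p * Λ = r := by
    rw [hp, hr]
    nth_rewrite 2 [← Real.rpow_one Λ]
    rw [← Real.rpow_add hΛ0]; norm_num
  have hI : IntegrableOn (fun x : ℝ => (x ^ (-(2 / 3) : ℝ) - p) * u x) (Ioi 0) := by
    have := hu.integrable_singular.sub (hu.integrable.const_mul p)
    refine this.congr_fun (fun x _ => ?_) measurableSet_Ioi
    simp; ring
  have h1 : ∫ x in Ioi 0, (x ^ (-(2 / 3) : ℝ) - p) * u x
      ≤ ∫ x in Ioc 0 Λ, (x ^ (-(2 / 3) : ℝ) - p) * u x := by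
    rw [← Ioc_union_Ioi_eq_Ioi hΛ0.le, setIntegral_union (Ioc_disjoint_Ioi le_rfl)
      measurableSet_Ioi (hI.mono_set Ioc_subset_Ioi_self)
      (hI.mono_set (Ioi_subset_Ioi hΛ0.le))]
    have : ∫ x in Ioi Λ, (x ^ (-(2 / 3) : ℝ) - p) * u x ≤ 0 := by
      refine setIntegral_nonpos measurableSet_Ioi fun x hx => ?_
      have hx' : Λ < x := hx
      refine mul_nonpos_of_nonpos_of_nonneg ?_ (hu.nonneg x (hΛ0.trans hx').le)
      have := Real.rpow_le_rpow_of_nonpos hΛ0 hx'.le (show (-(2 / 3) : ℝ) ≤ 0 by norm_num)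
      linarith
    linarith
  have h2 : ∫ x in Ioc 0 Λ, (x ^ (-(2 / 3) : ℝ) - p) * u x
      ≤ ∫ x in Ioc 0 Λ, (x ^ (-(2 / 3) : ℝ) - p) * u 0 := by
    refine setIntegral_mono_on (hI.mono_set Ioc_subset_Ioi_self) ?_ measurableSet_Ioc
      fun x hx => ?_
    · exact ((integrableOn_rpow_neg_two_thirds hΛ0.le).sub (by simp)).mul_const _
    · refine mul_le_mul_of_nonneg_left (hu.antitone (mem_Ici.2 le_rfl) hx.1.le hx.1.le) ?_
      have := Real.rpow_le_rpow_of_nonpos hx.1 hx.2 (show (-(2 / 3) : ℝ) ≤ 0 by norm_num)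
      linarith
  have h3 : ∫ x in Ioc 0 Λ, (x ^ (-(2 / 3) : ℝ) - p) * u 0 = (3 * r - Λ * p) * u 0 := by
    rw [integral_mul_const, integral_sub (integrableOn_rpow_neg_two_thirds hΛ0.le) (by simp),
      integral_rpow_neg_two_thirds hΛ0.le]
    simp [hΛ0.le, hr]
  have h4 : ∫ x in Ioi 0, (x ^ (-(2 / 3) : ℝ) - p) * u x
      = (∫ x in Ioi 0, x ^ (-(2 / 3) : ℝ) * u x) - p := by
    simp_rw [sub_mul]
    rw [integral_sub hu.integrable_singular (hu.integrable.const_mul p), integral_const_mul,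
      hu.mass, mul_one]
  have h5 : Λ * u 0 = 1 := by rw [hΛ]; field_simp
  rw [rootL, div_le_iff₀ h0]
  have h6 : p = r * u 0 := by rw [← hpr]; linear_combination (-p) * h5
  nlinarith

lemma paramL_le (hu : IsUnitProfile u) : paramL u ≤ 1 / u 0 := by
  have h0 := hu.zero_pos
  calc paramL u = rootL u ^ 3 := rfl
    _ ≤ ((1 / u 0) ^ (1 / 3 : ℝ)) ^ 3 := pow_le_pow_left₀ hu.rootL_pos.le hu.rootL_le 3
    _ = 1 / u 0 := by
      rw [← Real.rpow_natCast, ← Real.rpow_mul (by positivity)]; norm_num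

end IsUnitProfile

/-! ### The mean volume -/

/-- A fundamental theorem of calculus on `(0, ∞)` for an increasing function which may fail to be
differentiable at one point. -/
lemma integral_Ioi_deriv_of_nonneg_of_exception {g g' : ℝ → ℝ} {e l : ℝ} (he : 0 ≤ e)
    (hg : ContinuousOn g (Ici 0)) (hd : ∀ x, 0 < x → x ≠ e → HasDerivAt g (g' x) x)
    (hpos : ∀ x, 0 < x → 0 ≤ g' x) (hl : Tendsto g atTop (𝓝 l)) :
    ∫ x in Ioi 0, g' x = l - g 0 := by
  have hc1 : ContinuousOn g (Icc 0 e) := hg.mono Icc_subset_Ici_self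
  have hd1 : ∀ x ∈ Ioo 0 e, HasDerivAt g (g' x) x := fun x hx => hd x hx.1 hx.2.ne
  have hc2 : ContinuousWithinAt g (Ici e) e := (hg e he).mono (Ici_subset_Ici.2 he)
  have hd2 : ∀ x ∈ Ioi e, HasDerivAt g (g' x) x :=
    fun x hx => hd x (he.trans_lt hx) (ne_of_gt hx)
  have hp2 : ∀ x ∈ Ioi e, 0 ≤ g' x := fun x hx => hpos x (he.trans_lt hx)
  have hi1 : IntegrableOn g' (Ioc 0 e) :=
    intervalIntegral.integrableOn_deriv_of_nonneg hc1 hd1 fun x hx => hpos x hx.1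
  have hi2 : IntegrableOn g' (Ioi e) := integrableOn_Ioi_deriv_of_nonneg hc2 hd2 hp2 hl
  rw [← Ioc_union_Ioi_eq_Ioi he, setIntegral_union (Ioc_disjoint_Ioi le_rfl) measurableSet_Ioi
    hi1 hi2, integral_Ioi_of_hasDerivAt_of_nonneg hc2 hd2 hp2 hl,
    ← intervalIntegral.integral_of_le he, intervalIntegral.integral_eq_sub_of_hasDerivAt_of_le he
      hc1 hd1 ((intervalIntegrable_iff_integrableOn_Ioc_of_le he).2 hi1)]
  ring

namespace IsUnitProfile

variable {u : ℝ → ℝ}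

lemma tendsto_atTop (hu : IsUnitProfile u) : Tendsto u atTop (𝓝 0) := by
  refine squeeze_zero' (g := fun x => x⁻¹) ?_ ?_ tendsto_inv_atTop_zero
  · filter_upwards [eventually_ge_atTop 0] with x hx using hu.nonneg x hx
  · filter_upwards [eventually_gt_atTop 0] with x hx
    rw [← one_div, le_div_iff₀ hx, mul_comm]; exact hu.mul_le_one hx.le

lemma tendsto_integral (hu : IsUnitProfile u) :
    Tendsto (fun x => ∫ y in (0 : ℝ)..x, u y) atTop (𝓝 1) := by
  rw [← hu.mass]
  exact intervalIntegral_tendsto_integral_Ioi 0 hu.integrable tendsto_id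

lemma tendsto_mul_atTop (hu : IsUnitProfile u) : Tendsto (fun x => x * u x) atTop (𝓝 0) := by
  have h2 : Tendsto (fun x : ℝ => x / 2) atTop atTop := tendsto_id.atTop_div_const (by norm_num)
  have h := (hu.tendsto_integral.sub (hu.tendsto_integral.comp h2)).const_mul 2
  simp only [sub_self, mul_zero] at h
  refine squeeze_zero' ?_ ?_ h
  · filter_upwards [eventually_ge_atTop 0] with x hx using mul_nonneg hx (hu.nonneg x hx)
  · filter_upwards [eventually_ge_atTop 0] with x hx
    have hii : ∀ a, 0 ≤ a → IntervalIntegrable u volume 0 a := fun a ha =>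
      (intervalIntegrable_iff_integrableOn_Ioc_of_le ha).2
        (hu.integrable.mono_set Ioc_subset_Ioi_self)
    have e := intervalIntegral.integral_interval_sub_left (hii x hx) (hii (x / 2) (by linarith))
    have hle : ∫ y in (x / 2)..x, u x ≤ ∫ y in (x / 2)..x, u y := by
      refine intervalIntegral.integral_mono_on (by linarith) (by simp)
        ((hii _ (by linarith)).symm.trans (hii x hx)) fun y hy => ?_
      exact hu.antitone (mem_Ici.2 (by linarith [hy.1])) (mem_Ici.2 hx) hy.2
    rw [intervalIntegral.integral_const, smul_eq_mul] at hle
    simp only [Function.comp]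
    linarith

/-- If `u` is continuous, and differentiable wherever it is positive, then it is differentiable
off at most one point, the end of its support. -/
lemma exists_exception (hu : IsUnitProfile u)
    (hd : ∀ x, 0 < x → 0 < u x → DifferentiableAt ℝ u x) :
    ∃ e, 0 ≤ e ∧ ∀ x, 0 < x → x ≠ e → DifferentiableAt ℝ u x := by
  by_cases h : ∃ x, 0 < x ∧ u x = 0
  · obtain ⟨x₀, hx₀, hux₀⟩ := h
    set S := {x | 0 < x ∧ u x = 0} with hS
    have hbdd : BddBelow S := ⟨0, fun x hx => hx.1.le⟩
    have hne : S.Nonempty := ⟨x₀, hx₀, hux₀⟩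
    refine ⟨sInf S, le_csInf hne fun x hx => hx.1.le, fun x hx hxe => ?_⟩
    rcases lt_or_gt_of_ne hxe with h | h
    · refine hd x hx (lt_of_le_of_ne (hu.nonneg x hx.le) fun h0 => ?_)
      exact absurd (csInf_le hbdd (show x ∈ S from ⟨hx, h0.symm⟩)) (not_le.2 h)
    · obtain ⟨y, hy, hyx⟩ := (csInf_lt_iff hbdd hne).1 h
      have : u =ᶠ[𝓝 x] fun _ => 0 := by
        filter_upwards [Ioi_mem_nhds hyx] with z hz
        have hz' : 0 ≤ z := hy.1.le.trans (le_of_lt hz)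
        exact le_antisymm ((hu.antitone (mem_Ici.2 hy.1.le) hz' (le_of_lt hz)).trans_eq hy.2)
          (hu.nonneg z hz')
      exact this.differentiableAt_iff.2 (differentiableAt_const _)
  · push Not at h
    exact ⟨0, le_rfl, fun x hx _ => hd x hx (lt_of_le_of_ne (hu.nonneg x hx.le) (h x hx).symm)⟩

lemma deriv_nonpos (hu : IsUnitProfile u) {x : ℝ} (hx : 0 < x) : deriv u x ≤ 0 := by
  have h := hu.antitone.derivWithin_nonpos (x := x)
  rwa [derivWithin_of_mem_nhds (Ici_mem_nhds hx)] at h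

lemma integral_density (hu : IsUnitProfile u) (hc : ContinuousOn u (Ici 0))
    (hd : ∀ x, 0 < x → 0 < u x → DifferentiableAt ℝ u x) :
    ∫ x in Ioi (0 : ℝ), -deriv u x = u 0 := by
  obtain ⟨e, he, hde⟩ := hu.exists_exception hd
  rw [integral_Ioi_deriv_of_nonneg_of_exception (g := fun x => -u x) (l := -0) he hc.neg
    (fun x hx hxe => (hde x hx hxe).hasDerivAt.neg)
    (fun x hx => neg_nonneg.2 (hu.deriv_nonpos hx)) hu.tendsto_atTop.neg]
  ring

lemma integral_mul_density (hu : IsUnitProfile u) (hc : ContinuousOn u (Ici 0))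
    (hd : ∀ x, 0 < x → 0 < u x → DifferentiableAt ℝ u x) :
    ∫ x in Ioi (0 : ℝ), x * -deriv u x = 1 := by
  obtain ⟨e, he, hde⟩ := hu.exists_exception hd
  have hint : ∀ x, 0 ≤ x → IntervalIntegrable u volume 0 x := fun a ha =>
      (intervalIntegrable_iff_integrableOn_Ioc_of_le ha).2
        (hu.integrable.mono_set Ioc_subset_Ioi_self)
  rw [integral_Ioi_deriv_of_nonneg_of_exception
    (g := fun x => (∫ y in (0 : ℝ)..x, u y) - x * u x) (l := 1 - 0) he]
  · simp
  · refine ContinuousOn.sub ?_ (continuousOn_id.mul hc)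
    intro x hx
    have h1 : ContinuousOn (fun z => ∫ y in (0 : ℝ)..z, u y) (Icc 0 (x + 1)) := by
      have := intervalIntegral.continuousOn_primitive_interval (μ := volume) (f := u) (a := 0)
        (b := x + 1) ?_
      · rwa [uIcc_of_le (by linarith [mem_Ici.1 hx])] at this
      · rw [uIcc_of_le (by linarith [mem_Ici.1 hx])]
        exact (hc.mono Icc_subset_Ici_self).integrableOn_Icc
    refine (h1 x ⟨hx, by linarith⟩).mono_of_mem_nhdsWithin ?_
    refine mem_nhdsWithin.2 ⟨Iio (x + 1), isOpen_Iio, by simp, ?_⟩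
    rintro z ⟨hz1, hz2⟩
    exact ⟨hz2, le_of_lt hz1⟩
  · intro x hx hxe
    have hu' := (hde x hx hxe).hasDerivAt
    have h1 : HasDerivAt (fun z => ∫ y in (0 : ℝ)..z, u y) (u x) x := by
      refine intervalIntegral.integral_hasDerivAt_right (hint x hx.le) ?_
        (hde x hx hxe).continuousAt
      exact ⟨Ioi 0, Ioi_mem_nhds hx, hu.integrable.aestronglyMeasurable⟩
    refine (h1.sub ((hasDerivAt_id x).mul hu')).congr_deriv ?_
    simp only [id]; ring
  · exact fun x hx => mul_nonneg hx.le (neg_nonneg.2 (hu.deriv_nonpos hx))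
  · exact hu.tendsto_integral.sub hu.tendsto_mul_atTop

end IsUnitProfile

/-! ### Cube roots -/

/-- The cube root. -/
def cbrt (x : ℝ) : ℝ := x ^ (1 / 3 : ℝ)

lemma cbrt_nonneg {x : ℝ} (hx : 0 ≤ x) : 0 ≤ cbrt x := Real.rpow_nonneg hx _

lemma cbrt_pos {x : ℝ} (hx : 0 < x) : 0 < cbrt x := Real.rpow_pos_of_pos hx _

lemma cbrt_pow {x : ℝ} (hx : 0 ≤ x) : cbrt x ^ 3 = x := by
  rw [cbrt, ← Real.rpow_natCast, ← Real.rpow_mul hx]; norm_num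

lemma cbrt_le {x y : ℝ} (hx : 0 ≤ x) (h : x ≤ y) : cbrt x ≤ cbrt y :=
  Real.rpow_le_rpow hx h (by norm_num)

lemma cbrt_lt {x y : ℝ} (hx : 0 ≤ x) (h : x < y) : cbrt x < cbrt y :=
  Real.rpow_lt_rpow hx h (by norm_num)

lemma cbrt_of_pow {x : ℝ} (hx : 0 ≤ x) : cbrt (x ^ 3) = x := by
  rw [cbrt, ← Real.rpow_natCast, ← Real.rpow_mul hx]; norm_num

lemma cbrt_div {x y : ℝ} (hx : 0 ≤ x) (hy : 0 ≤ y) : cbrt (x / y) = cbrt x / cbrt y :=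
  Real.div_rpow hx hy _

lemma continuous_cbrt : Continuous cbrt :=
  Real.continuous_rpow_const (by norm_num)

lemma abs_cbrt_sub_le {δ x y : ℝ} (hδ : 0 < δ) (hx : δ ≤ x) (hy : δ ≤ y) :
    |cbrt x - cbrt y| ≤ |x - y| / cbrt δ ^ 2 := by
  have hx0 : 0 ≤ x := hδ.le.trans hx
  have hy0 : 0 ≤ y := hδ.le.trans hy
  have hd := cbrt_pos hδ
  have h1 := cbrt_le hδ.le hx
  have h2 := cbrt_le hδ.le hy
  have h4 := cbrt_nonneg hx0
  have h5 := cbrt_nonneg hy0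
  rw [le_div_iff₀ (by positivity)]
  have e : x - y = (cbrt x - cbrt y) * (cbrt x ^ 2 + cbrt x * cbrt y + cbrt y ^ 2) := by
    nth_rewrite 1 [← cbrt_pow hx0, ← cbrt_pow hy0]; ring
  rw [e, abs_mul, abs_of_nonneg (a := cbrt x ^ 2 + _ + _) (by positivity)]
  refine mul_le_mul_of_nonneg_left ?_ (abs_nonneg _)
  have h3 : cbrt δ ^ 2 ≤ cbrt x ^ 2 := pow_le_pow_left₀ hd.le h1 2
  nlinarith

/-! ### Characteristics -/

/-- A characteristic `dx/ds = (x / L(s))^{1/3} - 1` on the time interval `[0, t]`. It is positive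
before time `t`, and may reach zero at time `t`. -/
structure IsChar (L : ℝ → ℝ) (t : ℝ) (X : ℝ → ℝ) : Prop where
  continuousOn : ContinuousOn X (Icc 0 t)
  pos : ∀ s ∈ Ico 0 t, 0 < X s
  nonneg : 0 ≤ X t
  hasDerivAt : ∀ s ∈ Ioo 0 t, HasDerivAt X (cbrt (X s / L s) - 1) s

/-- A continuous and positive parameter function. -/
structure IsParam (L : ℝ → ℝ) : Prop where
  continuousOn : ContinuousOn L (Ici 0)
  pos : ∀ s, 0 ≤ s → 0 < L s

lemma IsParam.exists_lower {L : ℝ → ℝ} (hL : IsParam L) {t : ℝ} (ht : 0 ≤ t) :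
    ∃ l, 0 < l ∧ ∀ s ∈ Icc 0 t, l ≤ L s := by
  obtain ⟨s, hs, hmin⟩ := isCompact_Icc.exists_isMinOn (nonempty_Icc.2 ht)
    (hL.continuousOn.mono Icc_subset_Ici_self)
  exact ⟨L s, hL.pos s hs.1, fun r hr => hmin hr⟩

lemma IsParam.continuousOn_cbrt {L : ℝ → ℝ} (hL : IsParam L) :
    ContinuousOn (fun s => cbrt (L s)) (Ici 0) :=
  continuous_cbrt.comp_continuousOn hL.continuousOn

namespace IsChar

variable {L X Y : ℝ → ℝ} {t : ℝ}

lemma nonneg' (h : IsChar L t X) {s : ℝ} (hs : s ∈ Icc 0 t) : 0 ≤ X s := by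
  rcases hs.2.lt_or_eq with h1 | h1
  · exact (h.pos s ⟨hs.1, h1⟩).le
  · rw [h1]; exact h.nonneg

lemma restrict (h : IsChar L t X) {s : ℝ} (hs : s ∈ Icc 0 t) : IsChar L s X where
  continuousOn := h.continuousOn.mono (Icc_subset_Icc_right hs.2)
  pos r hr := h.pos r ⟨hr.1, hr.2.trans_le hs.2⟩
  nonneg := h.nonneg' hs
  hasDerivAt r hr := h.hasDerivAt r ⟨hr.1, hr.2.trans_le hs.2⟩

end IsChar

/-- Comparison from above: a continuous function which starts below the line of slope `c` and whose
derivative is below `c` whenever the function lies on the line stays below the line. -/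
lemma le_line_of_deriv_lt {f f' : ℝ → ℝ} {a b A c : ℝ} (hab : a ≤ b)
    (hf : ContinuousOn f (Icc a b)) (hd : ∀ s ∈ Ioo a b, HasDerivAt f (f' s) s)
    (ha : f a < A) (hb : ∀ s ∈ Ioo a b, f s = A + c * (s - a) → f' s < c) :
    f b ≤ A + c * (b - a) := by
  rcases hab.eq_or_lt with rfl | hab
  · simpa using ha.le
  -- The derivative is not available at the left end, so the comparison starts slightly later.
  have hcont : ContinuousWithinAt f (Ioi a) a :=
    ((hf a ⟨le_rfl, hab.le⟩).mono_of_mem_nhdsWithin (Icc_mem_nhdsGT_of_mem ⟨le_rfl, hab⟩))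
  have h1 : ∀ᶠ r in 𝓝[>] a, f r - c * (r - a) < A := by
    have : Tendsto (fun r => f r - c * (r - a)) (𝓝[>] a) (𝓝 (f a - c * (a - a))) := by
      refine Tendsto.sub hcont ?_
      exact (Continuous.tendsto (by fun_prop) a).mono_left nhdsWithin_le_nhds
    refine this.eventually_lt_const ?_
    simpa using ha
  obtain ⟨r, hr, hr2⟩ := (h1.and (Ioo_mem_nhdsGT hab)).exists
  have key := image_le_of_deriv_right_lt_deriv_boundary' (f := f) (f' := f') (a := r) (b := b)
    (B := fun s => A + c * (s - a)) (B' := fun _ => c)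
    (hf.mono (Icc_subset_Icc_left hr2.1.le))
    (fun s hs => (hd s ⟨hr2.1.trans_le hs.1, hs.2⟩).hasDerivWithinAt)
    (by linarith) (by fun_prop)
    (fun s _ => by
      have := (((hasDerivAt_id s).sub_const a).const_mul c).const_add A
      simpa using this.hasDerivWithinAt)
    (fun s hs h => hb s ⟨hr2.1.trans_le hs.1, hs.2⟩ h)
  exact key ⟨hr2.2.le, le_rfl⟩

/-- Comparison from below, see `le_line_of_deriv_lt`. -/
lemma line_le_of_lt_deriv {f f' : ℝ → ℝ} {a b A c : ℝ} (hab : a ≤ b)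
    (hf : ContinuousOn f (Icc a b)) (hd : ∀ s ∈ Ioo a b, HasDerivAt f (f' s) s)
    (ha : A < f a) (hb : ∀ s ∈ Ioo a b, f s = A + c * (s - a) → c < f' s) :
    A + c * (b - a) ≤ f b := by
  have := le_line_of_deriv_lt (f := fun s => -f s) (f' := fun s => -f' s) (A := -A) (c := -c) hab
    hf.neg (fun s hs => (hd s hs).neg) (by linarith)
    (fun s hs h => by have := hb s hs (by linarith); linarith)
  linarith

lemma mul_sub_le_sub_of_le_deriv {f f' : ℝ → ℝ} {a b c : ℝ} (hab : a ≤ b)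
    (hf : ContinuousOn f (Icc a b)) (hd : ∀ s ∈ Ioo a b, HasDerivAt f (f' s) s)
    (hc : ∀ s ∈ Ioo a b, c ≤ f' s) : c * (b - a) ≤ f b - f a := by
  have hm : MonotoneOn (fun s => f s - c * s) (Icc a b) := by
    refine monotoneOn_of_hasDerivWithinAt_nonneg (f' := fun s => f' s - c) (convex_Icc a b)
      (hf.sub (by fun_prop)) (fun s hs => ?_) (fun s hs => ?_)
    · rw [interior_Icc] at hs ⊢
      exact (((hd s hs).sub ((hasDerivAt_id s).const_mul c)).congr_deriv (by simp)).hasDerivWithinAt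
    · rw [interior_Icc] at hs
      linarith [hc s hs]
  have := hm ⟨le_rfl, hab⟩ ⟨hab, le_rfl⟩ hab
  simp only at this
  linarith

lemma exists_char_of_pos {L : ℝ → ℝ} (hL : IsParam L) {t x : ℝ} (ht : 0 ≤ t) (hx : 0 < x) :
    ∃ X, IsChar L t X ∧ X t = x := by
  obtain ⟨l, hl, hlL⟩ := hL.exists_lower ht
  set δ := min x l / 2 with hδ
  have hδ0 : 0 < δ := by positivity
  have hδx : δ < x := by have := min_le_left x l; have : 0 < min x l := by positivity
                         linarith
  have hδl : δ < l := by have := min_le_right x l; have : 0 < min x l := by positivity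
                         linarith
  set M := x + t + 1 with hM
  -- The velocity field is clamped to `[δ, M]`, which makes it bounded and Lipschitz.
  set f : ℝ → ℝ → ℝ := fun s y => cbrt (max δ (min y M)) / cbrt (L s) - 1 with hf
  have hM0 : 0 < M := by positivity
  have hcl := cbrt_pos hl
  have hcδ := cbrt_pos hδ0
  have hLs : ∀ s ∈ Icc 0 t, cbrt l ≤ cbrt (L s) := fun s hs => cbrt_le hl.le (hlL s hs)
  have hq0 : ∀ s ∈ Icc 0 t, ∀ y, 0 ≤ cbrt (max δ (min y M)) / cbrt (L s) := fun s hs y =>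
    div_nonneg (cbrt_nonneg (hδ0.le.trans (le_max_left _ _))) (hcl.le.trans (hLs s hs))
  have hb : ∀ s ∈ Icc 0 t, ∀ y, ‖f s y‖ ≤ cbrt M / cbrt l + 1 := by
    intro s hs y
    have h1 : cbrt (max δ (min y M)) / cbrt (L s) ≤ cbrt M / cbrt l := by
      refine div_le_div₀ (cbrt_nonneg hM0.le) (cbrt_le (hδ0.le.trans (le_max_left _ _)) ?_) hcl
        (hLs s hs)
      exact max_le (by linarith) (min_le_right _ _)
    rw [Real.norm_eq_abs, abs_le]
    have := hq0 s hs y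
    constructor <;> simp only [hf] <;> linarith
  set K1 : NNReal := ⟨cbrt M / cbrt l + 1, by have := cbrt_nonneg hM0.le; positivity⟩ with hK1
  set K2 : NNReal := ⟨1 / (cbrt δ ^ 2 * cbrt l), by positivity⟩ with hK2
  set a : NNReal := K1 * ⟨t, ht⟩ with ha
  have hP : IsPicardLindelof f (tmin := 0) (tmax := t) ⟨t, ht, le_rfl⟩ x a 0 K1 K2 := by
    refine ⟨fun s hs => ?_, fun y _ => ?_, fun s hs y _ => hb s hs y, ?_⟩
    · refine LipschitzOnWith.of_dist_le_mul fun y _ z _ => ?_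
      have h1 : |max δ (min y M) - max δ (min z M)| ≤ |y - z| := by
        refine (abs_max_sub_max_le_max _ _ _ _).trans ?_
        rw [sub_self, abs_zero]
        refine max_le (abs_nonneg _) ((abs_min_sub_min_le_max _ _ _ _).trans ?_)
        simp
      have h2 := abs_cbrt_sub_le hδ0 (le_max_left δ (min y M)) (le_max_left δ (min z M))
      have h3 := hLs s hs
      rw [Real.dist_eq, Real.dist_eq]
      simp only [hf]
      rw [sub_sub_sub_cancel_right, ← sub_div, abs_div, abs_of_pos (hcl.trans_le h3)]
      calc |cbrt (max δ (min y M)) - cbrt (max δ (min z M))| / cbrt (L s)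
          ≤ (|y - z| / cbrt δ ^ 2) / cbrt l := by
            refine div_le_div₀ (by positivity) (h2.trans ?_) hcl h3
            exact div_le_div_of_nonneg_right h1 (by positivity)
        _ = 1 / (cbrt δ ^ 2 * cbrt l) * |y - z| := by field_simp
    · refine ContinuousOn.sub (ContinuousOn.div continuousOn_const
        (hL.continuousOn_cbrt.mono Icc_subset_Ici_self) fun s hs => ?_) continuousOn_const
      exact (hcl.trans_le (hLs s hs)).ne'
    · simp only [sub_self, sub_zero, NNReal.coe_zero, max_eq_right ht]
      exact le_rfl
  obtain ⟨X, hXt, hX⟩ := hP.exists_eq_forall_mem_Icc_hasDerivWithinAt₀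
  simp only at hXt
  have hc : ContinuousOn X (Icc 0 t) := fun s hs => (hX s hs).continuousWithinAt
  have hd : ∀ s ∈ Ioo 0 t, HasDerivAt X (f s (X s)) s := fun s hs =>
    (hX s (Ioo_subset_Icc_self hs)).hasDerivAt (Icc_mem_nhds hs.1 hs.2)
  have hlow : ∀ s ∈ Icc 0 t, δ ≤ X s := by
    intro s hs
    by_contra! hlt
    -- Below `δ` the clamped velocity is negative, so the curve could not come back to `x > δ`.
    have := le_line_of_deriv_lt (A := δ) (c := 0) hs.2 (hc.mono (Icc_subset_Icc_left hs.1))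
      (fun r hr => hd r ⟨hs.1.trans_lt hr.1, hr.2⟩) hlt (fun r hr h => by
        have hr' : r ∈ Icc 0 t := ⟨hs.1.trans hr.1.le, hr.2.le⟩
        have e : max δ (min (X r) M) = δ := by
          rw [max_eq_left]; exact (min_le_left _ _).trans (by linarith)
        simp only [hf, e]
        have h3 : cbrt δ < cbrt (L r) := cbrt_lt hδ0.le (hδl.trans_le (hlL r hr'))
        have : cbrt δ / cbrt (L r) < 1 := by rw [div_lt_one (by linarith)]; exact h3
        linarith)
    rw [hXt] at this
    linarith
  have hup : ∀ s ∈ Icc 0 t, X s ≤ M := by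
    intro s hs
    have := mul_sub_le_sub_of_le_deriv (c := -1) hs.2 (hc.mono (Icc_subset_Icc_left hs.1))
      (fun r hr => hd r ⟨hs.1.trans_lt hr.1, hr.2⟩) (fun r hr => by
        have := hq0 r ⟨hs.1.trans hr.1.le, hr.2.le⟩ (X r)
        simp only [hf]; linarith)
    rw [hXt] at this
    linarith [hs.1]
  refine ⟨X, ⟨hc, fun s hs => hδ0.trans_le (hlow s ⟨hs.1, hs.2.le⟩), by rw [hXt]; exact hx.le,
    fun s hs => ?_⟩, hXt⟩
  have hs' := Ioo_subset_Icc_self hs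
  have := hd s hs
  have e : max δ (min (X s) M) = X s := by rw [min_eq_left (hup s hs'), max_eq_right (hlow s hs')]
  simp only [hf, e] at this
  rwa [cbrt_div (hδ0.le.trans (hlow s hs')) (hL.pos s hs'.1).le]

namespace IsChar

variable {L X Y : ℝ → ℝ} {t : ℝ}

lemma cbrt_ratio (hL : IsParam L) (h : IsChar L t X) {s : ℝ} (hs : s ∈ Icc 0 t) :
    cbrt (X s / L s) = cbrt (X s) / cbrt (L s) :=
  cbrt_div (h.nonneg' hs) (hL.pos s hs.1).le

/-- A cluster which is small compared with `L` shrinks at speed at least `1/2` until its end. -/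
lemma half_sub_le (hL : IsParam L) (h : IsChar L t X) {s l : ℝ} (hs : 0 ≤ s) (hst : s ≤ t)
    (hl : ∀ r ∈ Icc s t, l ≤ L r) : min ((t - s) / 2) (l / 8) ≤ X s := by
  by_contra! hlt
  obtain ⟨A, hA, hA2⟩ := exists_between hlt
  have := le_line_of_deriv_lt (A := A) (c := -(1 / 2)) hst
    (h.continuousOn.mono (Icc_subset_Icc_left hs))
    (fun r hr => h.hasDerivAt r ⟨hs.trans_lt hr.1, hr.2⟩) hA (fun r hr he => by
      have hr' : r ∈ Icc 0 t := ⟨hs.trans hr.1.le, hr.2.le⟩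
      have hLr := hL.pos r hr'.1
      have hlr := hl r ⟨hr.1.le, hr.2.le⟩
      have hx8 : X r / L r < (1 / 2) ^ 3 := by
        rw [div_lt_iff₀ hLr]
        have := hA2.trans_le (min_le_right _ _)
        have := hr.1
        nlinarith
      have := cbrt_lt (div_nonneg (h.nonneg' hr') hLr.le) hx8
      rw [cbrt_of_pow (by norm_num)] at this
      linarith)
  have := h.nonneg
  have := hA2.trans_le (min_le_left _ _)
  linarith

/-- Two characteristics approach each other backwards in time. -/
lemma abs_sub_le (hL : IsParam L) (hX : IsChar L t X) (hY : IsChar L t Y) {s : ℝ}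
    (hs : s ∈ Icc 0 t) : |X s - Y s| ≤ |X t - Y t| := by
  have := mul_sub_le_sub_of_le_deriv (c := 0) (f := fun r => (X r - Y r) ^ 2) hs.2
    (((hX.continuousOn.sub hY.continuousOn).pow 2).mono (Icc_subset_Icc_left hs.1))
    (fun r hr => ((hX.hasDerivAt r ⟨hs.1.trans_lt hr.1, hr.2⟩).sub
      (hY.hasDerivAt r ⟨hs.1.trans_lt hr.1, hr.2⟩)).pow 2) (fun r hr => by
      have hr' : r ∈ Icc 0 t := ⟨hs.1.trans hr.1.le, hr.2.le⟩
      rw [hX.cbrt_ratio hL hr', hY.cbrt_ratio hL hr']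
      have hl := cbrt_pos (hL.pos r hr'.1)
      have e : cbrt (X r) / cbrt (L r) - 1 - (cbrt (Y r) / cbrt (L r) - 1)
          = (cbrt (X r) - cbrt (Y r)) / cbrt (L r) := by ring
      simp only [e, Pi.sub_apply]
      have hm : 0 ≤ (X r - Y r) * (cbrt (X r) - cbrt (Y r)) := by
        rcases le_total (X r) (Y r) with h | h
        · have := cbrt_le (hX.nonneg' hr') h
          exact mul_nonneg_of_nonpos_of_nonpos (by linarith) (by linarith)
        · have := cbrt_le (hY.nonneg' hr') h
          exact mul_nonneg (by linarith) (by linarith)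
      have := div_nonneg hm hl.le
      norm_num
      rw [mul_assoc, ← mul_div_assoc]
      positivity)
  rw [zero_mul] at this
  exact sq_le_sq.1 (by linarith)

end IsChar

lemma abs_cbrt_sub_le_div {l x y x' y' δ : ℝ} (hδ : 0 < δ) (hl : 0 < l) (hx : δ ≤ x) (hy : δ ≤ y)
    (hx' : x' = cbrt (x / l)) (hy' : y' = cbrt (y / l)) :
    |x' - y'| ≤ |x - y| / (cbrt δ ^ 2 * cbrt l) := by
  rw [hx', hy', cbrt_div (hδ.le.trans hx) hl.le, cbrt_div (hδ.le.trans hy) hl.le, ← sub_div,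
    abs_div, abs_of_pos (cbrt_pos hl), ← div_div]
  exact div_le_div_of_nonneg_right (abs_cbrt_sub_le hδ hx hy) (cbrt_pos hl).le

/-- Through each point `(x, t)`, `x ≥ 0`, there is a characteristic on `[0, t]`. At `x = 0`, where
the velocity is not Lipschitz, it is a limit of the characteristics through `(1 / (n + 1), t)`. -/
lemma exists_char {L : ℝ → ℝ} (hL : IsParam L) {t x : ℝ} (ht : 0 ≤ t) (hx : 0 ≤ x) :
    ∃ X, IsChar L t X ∧ X t = x := by
  rcases hx.lt_or_eq with hx | rfl
  · exact exists_char_of_pos hL ht hx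
  choose X hX hXt using fun n : ℕ =>
    exists_char_of_pos hL ht (x := 1 / ((n : ℝ) + 1)) (by positivity)
  have hlim : Tendsto (fun n : ℕ => 1 / ((n : ℝ) + 1)) atTop (𝓝 0) :=
    tendsto_one_div_add_atTop_nhds_zero_nat
  have hcau : UniformCauchySeqOn X atTop (Icc 0 t) := by
    rw [Metric.uniformCauchySeqOn_iff]
    intro ε hε
    obtain ⟨N, hN⟩ := Metric.cauchySeq_iff.1 hlim.cauchySeq ε hε
    refine ⟨N, fun m hm n hn s hs => lt_of_le_of_lt ?_ (hN m hm n hn)⟩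
    rw [Real.dist_eq, Real.dist_eq, ← hXt, ← hXt]
    exact (hX m).abs_sub_le hL (hX n) hs
  have hpt : ∀ s ∈ Icc 0 t, ∃ y, Tendsto (fun n => X n s) atTop (𝓝 y) := fun s hs =>
    cauchySeq_tendsto_of_complete (hcau.cauchySeq hs)
  choose! Z hZ using hpt
  have hunif : TendstoUniformlyOn X Z atTop (Icc 0 t) :=
    hcau.tendstoUniformlyOn_of_tendsto hZ
  have hZc : ContinuousOn Z (Icc 0 t) :=
    hunif.continuousOn (Frequently.of_forall fun n => (hX n).continuousOn)
  have hZt : Z t = 0 := by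
    refine tendsto_nhds_unique (hZ t ⟨ht, le_rfl⟩) ?_
    simpa only [hXt] using hlim
  obtain ⟨l, hl, hlL⟩ := hL.exists_lower ht
  have hXlow : ∀ n, ∀ s ∈ Icc 0 t, min ((t - s) / 2) (l / 8) ≤ X n s := fun n s hs =>
    (hX n).half_sub_le hL hs.1 hs.2 fun r hr => hlL r ⟨hs.1.trans hr.1, hr.2⟩
  have hZlow : ∀ s ∈ Icc 0 t, min ((t - s) / 2) (l / 8) ≤ Z s := fun s hs =>
    ge_of_tendsto' (hZ s hs) fun n => hXlow n s hs
  refine ⟨Z, ⟨hZc, fun s hs => ?_, hZt.ge, fun s hs => ?_⟩, hZt⟩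
  · refine lt_of_lt_of_le ?_ (hZlow s ⟨hs.1, hs.2.le⟩)
    exact lt_min (by linarith [hs.2]) (by positivity)
  · -- Derivatives converge uniformly on `(0, r)` for some `r` between `s` and `t`.
    obtain ⟨r, hr1, hr2⟩ := exists_between hs.2
    set δ := min ((t - r) / 2) (l / 8) with hδ
    have hδ0 : 0 < δ := lt_min (by linarith) (by positivity)
    have hδle : ∀ q ∈ Ioo 0 r, δ ≤ min ((t - q) / 2) (l / 8) := fun q hq =>
      min_le_min_right _ (by linarith [hq.2])
    refine hasDerivAt_of_tendstoUniformlyOn (f := X) (l := atTop)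
      (f' := fun n q => cbrt (X n q / L q) - 1) (g' := fun q => cbrt (Z q / L q) - 1)
      (s := Ioo 0 r) isOpen_Ioo ?_
      (Eventually.of_forall fun n q hq => (hX n).hasDerivAt q ⟨hq.1, hq.2.trans hr2⟩)
      (fun q hq => hZ q ⟨hq.1.le, (hq.2.trans hr2).le⟩) ⟨hs.1, hr1⟩
    rw [Metric.tendstoUniformlyOn_iff] at hunif ⊢
    intro ε hε
    have hk : 0 < cbrt δ ^ 2 * cbrt l := mul_pos (pow_pos (cbrt_pos hδ0) 2) (cbrt_pos hl)
    filter_upwards [hunif (ε * (cbrt δ ^ 2 * cbrt l)) (by positivity)] with n hn q hq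
    have hq' : q ∈ Icc 0 t := ⟨hq.1.le, (hq.2.trans hr2).le⟩
    have h1 := hn q hq'
    rw [Real.dist_eq] at h1 ⊢
    rw [sub_sub_sub_cancel_right]
    refine (abs_cbrt_sub_le_div hδ0 (hL.pos q hq'.1) ((hδle q hq).trans (hZlow q hq'))
      ((hδle q hq).trans (hXlow n q hq')) rfl rfl).trans_lt ?_
    have h2 : cbrt δ ^ 2 * cbrt l ≤ cbrt δ ^ 2 * cbrt (L q) :=
      mul_le_mul_of_nonneg_left (cbrt_le hl.le (hlL q hq')) (sq_nonneg _)
    rw [div_lt_iff₀ (hk.trans_le h2)]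
    exact h1.trans_le (mul_le_mul_of_nonneg_left h2 hε.le)

/-! ### Gaps between characteristics -/

/-- The relative growth rate of the gap `Y - X` between two characteristics, that is, the divided
difference of the velocity field between `X s` and `Y s`. -/
def gapRate (L X Y : ℝ → ℝ) (s : ℝ) : ℝ :=
  1 / (cbrt (X s) ^ 2 + cbrt (X s) * cbrt (Y s) + cbrt (Y s) ^ 2) / cbrt (L s)

namespace IsChar

variable {L X Y Z W : ℝ → ℝ} {t : ℝ}

lemma pos' (h : IsChar L t X) (ht : 0 < X t) {s : ℝ} (hs : s ∈ Icc 0 t) : 0 < X s := by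
  rcases hs.2.lt_or_eq with h1 | h1
  · exact h.pos s ⟨hs.1, h1⟩
  · rwa [h1]

lemma continuousOn_gapRate (hL : IsParam L) (hX : IsChar L t X) (hY : IsChar L t Y)
    (ht : 0 < Y t) : ContinuousOn (gapRate L X Y) (Icc 0 t) := by
  have cX := continuous_cbrt.comp_continuousOn hX.continuousOn
  have cY := continuous_cbrt.comp_continuousOn hY.continuousOn
  have cL := hL.continuousOn_cbrt.mono (Icc_subset_Ici_self : Icc 0 t ⊆ Ici 0)
  refine (continuousOn_const.div (((cX.pow 2).add (cX.mul cY)).add (cY.pow 2))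
    fun s hs => ?_).div cL fun s hs => (cbrt_pos (hL.pos s hs.1)).ne'
  have h1 := cbrt_nonneg (hX.nonneg' hs)
  have h2 := cbrt_pos (hY.pos' ht hs)
  exact (by positivity : (0 : ℝ) <
    cbrt (X s) ^ 2 + cbrt (X s) * cbrt (Y s) + cbrt (Y s) ^ 2).ne'

lemma gapRate_nonneg (hL : IsParam L) (hX : IsChar L t X) (hY : IsChar L t Y) {s : ℝ}
    (hs : s ∈ Icc 0 t) : 0 ≤ gapRate L X Y s := by
  have h1 := cbrt_nonneg (hX.nonneg' hs)
  have h2 := cbrt_nonneg (hY.nonneg' hs)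
  have h3 := cbrt_pos (hL.pos s hs.1)
  rw [gapRate]; positivity

lemma hasDerivAt_sub (hL : IsParam L) (hX : IsChar L t X) (hY : IsChar L t Y) {s : ℝ}
    (hs : s ∈ Ioo 0 t) :
    HasDerivAt (fun r => Y r - X r) (gapRate L X Y s * (Y s - X s)) s := by
  have hs' := Ioo_subset_Icc_self hs
  refine ((hY.hasDerivAt s hs).sub (hX.hasDerivAt s hs)).congr_deriv ?_
  rw [hX.cbrt_ratio hL hs', hY.cbrt_ratio hL hs', gapRate]
  have h1 := cbrt_pos (hX.pos s ⟨hs.1.le, hs.2⟩)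
  have h2 := cbrt_pos (hY.pos s ⟨hs.1.le, hs.2⟩)
  have h3 := cbrt_pos (hL.pos s hs.1.le)
  have e : Y s - X s = (cbrt (Y s) - cbrt (X s)) *
      (cbrt (X s) ^ 2 + cbrt (X s) * cbrt (Y s) + cbrt (Y s) ^ 2) := by
    nth_rewrite 1 [← cbrt_pow (hX.nonneg' hs'), ← cbrt_pow (hY.nonneg' hs')]; ring
  rw [e]
  field_simp
  ring

lemma gap_eq (hL : IsParam L) (hX : IsChar L t X) (hY : IsChar L t Y) (ht : 0 < Y t) {r s : ℝ}
    (hr : 0 ≤ r) (hrs : r ≤ s) (hst : s ≤ t) :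
    Y s - X s = (Y r - X r) * Real.exp (∫ q in r..s, gapRate L X Y q) := by
  rcases hrs.eq_or_lt with rfl | hlt
  · simp
  have hc : ContinuousOn (gapRate L X Y) (Icc r s) :=
    (hX.continuousOn_gapRate hL hY ht).mono (Icc_subset_Icc hr hst)
  have hii : ∀ q ∈ Icc r s, IntervalIntegrable (gapRate L X Y) volume r q := fun q hq =>
    (hc.mono (Icc_subset_Icc_right hq.2)).intervalIntegrable_of_Icc hq.1
  set G := fun q => ∫ p in r..q, gapRate L X Y p with hG
  have hGc : ContinuousOn G (Icc r s) := by
    have := intervalIntegral.continuousOn_primitive_interval (μ := volume)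
      (f := gapRate L X Y) (a := r) (b := s) (by
        rw [uIcc_of_le hrs]; exact hc.integrableOn_Icc)
    rwa [uIcc_of_le hrs] at this
  have hGd : ∀ q ∈ Ioo r s, HasDerivAt G (gapRate L X Y q) q := fun q hq =>
    intervalIntegral.integral_hasDerivAt_right (hii q (Ioo_subset_Icc_self hq))
      (hc.stronglyMeasurableAtFilter_nhdsWithin measurableSet_Icc q |>.filter_mono (by
        rw [nhdsWithin_eq_nhds.2 (Icc_mem_nhds hq.1 hq.2)]))
      (hc.continuousAt (Icc_mem_nhds hq.1 hq.2))
  obtain ⟨q, hq, hq2⟩ := exists_hasDerivAt_eq_slope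
    (fun q => (Y q - X q) * Real.exp (-G q)) (fun _ => 0) hlt
    (((hY.continuousOn.sub hX.continuousOn).mono (Icc_subset_Icc hr hst)).mul
      (Real.continuous_exp.comp_continuousOn hGc.neg))
    (fun q hq => by
      refine ((hX.hasDerivAt_sub hL hY ⟨hr.trans_lt hq.1, hq.2.trans_le hst⟩).mul
        (hGd q hq).neg.exp).congr_deriv ?_
      simp only [Pi.neg_apply]
      ring)
  have hG0 : G r = 0 := by simp [hG]
  rw [eq_div_iff (by linarith)] at hq2
  simp only [hG0, neg_zero, Real.exp_zero, mul_one, zero_mul] at hq2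
  have h1 : (Y s - X s) * Real.exp (-G s) = Y r - X r := by linarith
  rw [← h1, mul_assoc, ← Real.exp_add]
  simp [hG]

lemma gap_pos (hL : IsParam L) (hX : IsChar L t X) (hY : IsChar L t Y) (h : X t < Y t) {s : ℝ}
    (hs : s ∈ Icc 0 t) : X s < Y s := by
  have := hX.gap_eq hL hY (hX.nonneg.trans_lt h) hs.1 hs.2 le_rfl
  have h2 : 0 < (Y s - X s) * Real.exp (∫ q in s..t, gapRate L X Y q) := by linarith
  have := pos_of_mul_pos_left h2 (Real.exp_pos _).le
  linarith

lemma intervalIntegrable_gapRate (hL : IsParam L) (hX : IsChar L t X) (hY : IsChar L t Y)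
    (ht : 0 < Y t) {r s : ℝ} (hr : 0 ≤ r) (hrs : r ≤ s) (hst : s ≤ t) :
    IntervalIntegrable (gapRate L X Y) volume r s :=
  ((hX.continuousOn_gapRate hL hY ht).mono (Icc_subset_Icc hr hst)).intervalIntegrable_of_Icc hrs

/-- Gaps grow at least exponentially if their rate is bounded below. -/
lemma gap_le_of_le_rate (hL : IsParam L) (hX : IsChar L t X) (hY : IsChar L t Y) (h : X t < Y t)
    {r s k : ℝ} (hr : 0 ≤ r) (hrs : r ≤ s) (hst : s ≤ t)
    (hk : ∀ q ∈ Icc r s, k ≤ gapRate L X Y q) :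
    (Y r - X r) * Real.exp (k * (s - r)) ≤ Y s - X s := by
  have ht := hX.nonneg.trans_lt h
  rw [hX.gap_eq hL hY ht hr hrs hst]
  have h0 := hX.gap_pos hL hY h (s := r) ⟨hr, hrs.trans hst⟩
  refine mul_le_mul_of_nonneg_left (Real.exp_le_exp.2 ?_) (by linarith)
  have := intervalIntegral.integral_mono_on hrs (by simp)
    (hX.intervalIntegrable_gapRate hL hY ht hr hrs hst) (f := fun _ => k) hk
  rw [intervalIntegral.integral_const, smul_eq_mul] at this
  linarith

/-- Gaps grow at most exponentially if their rate is bounded above. -/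
lemma gap_le_of_rate_le (hL : IsParam L) (hX : IsChar L t X) (hY : IsChar L t Y) (h : X t < Y t)
    {r s k : ℝ} (hr : 0 ≤ r) (hrs : r ≤ s) (hst : s ≤ t)
    (hk : ∀ q ∈ Icc r s, gapRate L X Y q ≤ k) :
    Y s - X s ≤ (Y r - X r) * Real.exp (k * (s - r)) := by
  have ht := hX.nonneg.trans_lt h
  rw [hX.gap_eq hL hY ht hr hrs hst]
  have h0 := hX.gap_pos hL hY h (s := r) ⟨hr, hrs.trans hst⟩
  refine mul_le_mul_of_nonneg_left (Real.exp_le_exp.2 ?_) (by linarith)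
  have := intervalIntegral.integral_mono_on hrs
    (hX.intervalIntegrable_gapRate hL hY ht hr hrs hst) (by simp) (g := fun _ => k) hk
  rw [intervalIntegral.integral_const, smul_eq_mul] at this
  linarith

/-- The characteristic flow is concave: the ratio of the upper to the lower of two adjacent gaps
decreases. The velocity field is a concave function of the volume. -/
lemma gap_concave (hL : IsParam L) (hX : IsChar L t X) (hY : IsChar L t Y) (hZ : IsChar L t Z)
    (h1 : X t < Y t) (h2 : Y t < Z t) (ht : 0 ≤ t) :
    (Z t - Y t) * (Y 0 - X 0) ≤ (Y t - X t) * (Z 0 - Y 0) := by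
  have hy0 := hX.nonneg.trans_lt h1
  have hz0 := hy0.trans h2
  have i1 := hX.intervalIntegrable_gapRate hL hY hy0 le_rfl ht le_rfl
  have i2 := hY.intervalIntegrable_gapRate hL hZ hz0 le_rfl ht le_rfl
  rw [hX.gap_eq hL hY hy0 le_rfl ht le_rfl, hY.gap_eq hL hZ hz0 le_rfl ht le_rfl]
  have hm := intervalIntegral.integral_mono_on ht i2 i1 (fun q hq => by
    have a1 := cbrt_nonneg (hX.nonneg' hq)
    have a2 := cbrt_pos (hY.pos' hy0 hq)
    have a3 := cbrt_le (hX.nonneg' hq)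
      ((hX.gap_pos hL hY h1 hq).trans (hY.gap_pos hL hZ h2 hq)).le
    have a4 := cbrt_pos (hL.pos q hq.1)
    refine div_le_div_of_nonneg_right (one_div_le_one_div_of_le (by positivity) ?_) a4.le
    nlinarith)
  have hp1 := hX.gap_pos hL hY h1 (s := 0) ⟨le_rfl, ht⟩
  have hp2 := hY.gap_pos hL hZ h2 (s := 0) ⟨le_rfl, ht⟩
  have := mul_le_mul_of_nonneg_left (Real.exp_le_exp.2 hm)
    (mul_nonneg (sub_nonneg.2 hp1.le) (sub_nonneg.2 hp2.le))
  linarith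

end IsChar

/-- The third divided difference of the cube root, taken with respect to four cube roots, is
nonnegative. -/
lemma rate_cross_le {a b c d : ℝ} (ha : 0 ≤ a) (hab : a ≤ b) (hb : 0 < b) (hbc : b ≤ c)
    (hcd : c ≤ d) :
    1 / (a ^ 2 + a * c + c ^ 2) + 1 / (b ^ 2 + b * d + d ^ 2)
      ≤ 1 / (a ^ 2 + a * b + b ^ 2) + 1 / (c ^ 2 + c * d + d ^ 2) := by
  have hc : 0 < c := hb.trans_le hbc
  have hd : 0 < d := hc.trans_le hcd
  have hP : 0 < a ^ 2 + a * b + b ^ 2 := by positivity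
  have hQ : 0 < a ^ 2 + a * c + c ^ 2 := by positivity
  have hR : 0 < b ^ 2 + b * d + d ^ 2 := by positivity
  have hS : 0 < c ^ 2 + c * d + d ^ 2 := by positivity
  have e1 : 1 / (a ^ 2 + a * b + b ^ 2) - 1 / (a ^ 2 + a * c + c ^ 2)
      = (c - b) * ((a + b + c) / ((a ^ 2 + a * b + b ^ 2) * (a ^ 2 + a * c + c ^ 2))) := by
    field_simp; ring
  have e2 : 1 / (b ^ 2 + b * d + d ^ 2) - 1 / (c ^ 2 + c * d + d ^ 2)
      = (c - b) * ((d + b + c) / ((b ^ 2 + b * d + d ^ 2) * (c ^ 2 + c * d + d ^ 2))) := by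
    field_simp; ring
  have h1 : a ^ 2 + a * b + b ^ 2 ≤ b ^ 2 + b * d + d ^ 2 := by nlinarith
  have h2 : (d + b + c) * (a ^ 2 + a * c + c ^ 2) ≤ (a + b + c) * (c ^ 2 + c * d + d ^ 2) := by
    obtain ⟨e, he⟩ : ∃ e, d = a + e := ⟨d - a, by ring⟩
    have he0 : 0 ≤ e := by linarith
    have : (a + b + c) * (c ^ 2 + c * d + d ^ 2) - (d + b + c) * (a ^ 2 + a * c + c ^ 2)
        = e * (a ^ 2 + 2 * a * b + 2 * a * c + e * (a + b + c) + c * b) := by rw [he]; ring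
    have : 0 ≤ e * (a ^ 2 + 2 * a * b + 2 * a * c + e * (a + b + c) + c * b) := by positivity
    linarith
  have h3 : (d + b + c) / ((b ^ 2 + b * d + d ^ 2) * (c ^ 2 + c * d + d ^ 2))
      ≤ (a + b + c) / ((a ^ 2 + a * b + b ^ 2) * (a ^ 2 + a * c + c ^ 2)) := by
    rw [div_le_div_iff₀ (by positivity) (by positivity)]
    calc (d + b + c) * ((a ^ 2 + a * b + b ^ 2) * (a ^ 2 + a * c + c ^ 2))
        = (a ^ 2 + a * b + b ^ 2) * ((d + b + c) * (a ^ 2 + a * c + c ^ 2)) := by ring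
      _ ≤ (b ^ 2 + b * d + d ^ 2) * ((a + b + c) * (c ^ 2 + c * d + d ^ 2)) :=
          mul_le_mul h1 h2 (by positivity) hR.le
      _ = _ := by ring
  have := mul_le_mul_of_nonneg_left h3 (sub_nonneg.2 hbc)
  linarith

/-- The cross ratio `|XY| |ZW| / (|XZ| |YW|)` of four characteristics increases in time. The
velocity field has a nonnegative third derivative in the volume, so the flow has a nonnegative
Schwarzian derivative. -/
lemma IsChar.cross_ratio {L X Y Z W : ℝ → ℝ} {t : ℝ} (hL : IsParam L) (hX : IsChar L t X)
    (hY : IsChar L t Y) (hZ : IsChar L t Z) (hW : IsChar L t W) (h1 : X t < Y t) (h2 : Y t < Z t)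
    (h3 : Z t < W t) (ht : 0 ≤ t) :
    ((Y 0 - X 0) * (W 0 - Z 0)) * ((Z t - X t) * (W t - Y t))
      ≤ ((Z 0 - X 0) * (W 0 - Y 0)) * ((Y t - X t) * (W t - Z t)) := by
  have hy0 := hX.nonneg.trans_lt h1
  have hz0 := hy0.trans h2
  have hw0 := hz0.trans h3
  have i1 := hX.intervalIntegrable_gapRate hL hY hy0 le_rfl ht le_rfl
  have i2 := hX.intervalIntegrable_gapRate hL hZ hz0 le_rfl ht le_rfl
  have i3 := hY.intervalIntegrable_gapRate hL hW hw0 le_rfl ht le_rfl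
  have i4 := hZ.intervalIntegrable_gapRate hL hW hw0 le_rfl ht le_rfl
  have hm := intervalIntegral.integral_mono_on ht (i2.add i3) (i1.add i4) (fun q hq => by
    have a4 := cbrt_pos (hL.pos q hq.1)
    simp only [gapRate]
    rw [← add_div, ← add_div]
    refine div_le_div_of_nonneg_right ?_ a4.le
    exact rate_cross_le (cbrt_nonneg (hX.nonneg' hq))
      (cbrt_le (hX.nonneg' hq) (hX.gap_pos hL hY h1 hq).le) (cbrt_pos (hY.pos' hy0 hq))
      (cbrt_le (hY.nonneg' hq) (hY.gap_pos hL hZ h2 hq).le)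
      (cbrt_le (hZ.nonneg' hq) (hZ.gap_pos hL hW h3 hq).le))
  rw [intervalIntegral.integral_add i2 i3, intervalIntegral.integral_add i1 i4] at hm
  have h0 : (0 : ℝ) ∈ Icc 0 t := ⟨le_rfl, ht⟩
  have p1 := sub_nonneg.2 (hX.gap_pos hL hY h1 h0).le
  have p2 := sub_nonneg.2 (hX.gap_pos hL hZ (h1.trans h2) h0).le
  have p3 := sub_nonneg.2 (hY.gap_pos hL hW (h2.trans h3) h0).le
  have p4 := sub_nonneg.2 (hZ.gap_pos hL hW h3 h0).le
  rw [hX.gap_eq hL hY hy0 le_rfl ht le_rfl, hX.gap_eq hL hZ hz0 le_rfl ht le_rfl,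
    hY.gap_eq hL hW hw0 le_rfl ht le_rfl, hZ.gap_eq hL hW hw0 le_rfl ht le_rfl]
  have := mul_le_mul_of_nonneg_left (Real.exp_le_exp.2 hm)
    (mul_nonneg (mul_nonneg p1 p2) (mul_nonneg p3 p4))
  rw [Real.exp_add, Real.exp_add] at this
  linarith

/-! ### Solutions along characteristics -/

/-- The parameter `L(t)` of a solution. -/
def lenL (w : ℝ → ℝ → ℝ) (t : ℝ) : ℝ := paramL fun y => w y t

/-- A continuous nonnegative function whose derivative vanishes wherever the function is positive
takes the same value at both ends. -/
lemma eq_of_hasDerivAt_zero_of_pos {f : ℝ → ℝ} {t : ℝ} (ht : 0 ≤ t)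
    (hf : ContinuousOn f (Icc 0 t)) (h0 : ∀ s ∈ Icc 0 t, 0 ≤ f s)
    (hd : ∀ s ∈ Ioo 0 t, 0 < f s → HasDerivAt f 0 s) : f t = f 0 := by
  rcases ht.eq_or_lt with rfl | ht
  · rfl
  -- Truncation from below at a level `η > 0` gives a function with zero derivative throughout.
  have key : ∀ η, 0 < η → max (f t) η = max (f 0) η := by
    intro η hη
    obtain ⟨c, _, hc⟩ := exists_hasDerivAt_eq_slope (fun s => max (f s) η) (fun _ => 0) ht
      (hf.sup continuousOn_const) (fun s hs => by
        rcases (h0 s (Ioo_subset_Icc_self hs)).eq_or_lt with h | h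
        · have hca : ContinuousAt f s := hf.continuousAt (Icc_mem_nhds hs.1 hs.2)
          have : (fun r => max (f r) η) =ᶠ[𝓝 s] fun _ => η := by
            filter_upwards [hca.eventually_lt_const (show f s < η by linarith)] with r hr
            exact max_eq_right hr.le
          exact (hasDerivAt_const s η).congr_of_eventuallyEq this
        · have h1 := hd s hs h
          rw [hasDerivAt_iff_isLittleO] at h1 ⊢
          refine Asymptotics.IsBigO.trans_isLittleO (Asymptotics.IsBigO.of_bound 1 ?_) h1
          refine Eventually.of_forall fun r => ?_
          simp only [smul_zero, sub_zero, one_mul, Real.norm_eq_abs]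
          refine (abs_max_sub_max_le_max _ _ _ _).trans ?_
          simp)
    rw [eq_div_iff (by linarith), zero_mul] at hc
    linarith
  have a0 := h0 0 ⟨le_rfl, ht.le⟩
  have at' := h0 t ⟨ht.le, le_rfl⟩
  by_contra hne
  have hm := key ((f t + f 0) / 2) (by
    rcases a0.eq_or_lt with h | h
    · rcases at'.eq_or_lt with h' | h'
      · exact absurd (h'.symm.trans h) hne
      · linarith
    · linarith)
  rcases lt_or_gt_of_ne hne with h | h
  · rw [max_eq_right (by linarith), max_eq_left (by linarith)] at hm; linarith
  · rw [max_eq_left (by linarith), max_eq_right (by linarith)] at hm; linarith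

namespace IsSolution

variable {w₀ : ℝ → ℝ} {w : ℝ → ℝ → ℝ}

lemma isUnitProfile (hw : IsSolution w₀ w) {t : ℝ} (ht : 0 ≤ t) :
    IsUnitProfile fun x => w x t where
  nonneg x hx := hw.nonneg x t hx ht
  antitone := hw.antitone t ht
  integrable := hw.integrable t ht
  mass := hw.conservation t ht

lemma continuousOn_time (hw : IsSolution w₀ w) {x : ℝ} (hx : 0 ≤ x) :
    ContinuousOn (fun t => w x t) (Ici 0) :=
  hw.continuousOn.comp (f := fun t => (x, t)) (by fun_prop) fun _ ht => ⟨hx, ht⟩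

lemma continuousOn_space (hw : IsSolution w₀ w) {t : ℝ} (ht : 0 ≤ t) :
    ContinuousOn (fun x => w x t) (Ici 0) :=
  hw.continuousOn.comp (f := fun x => (x, t)) (by fun_prop) fun _ hx => ⟨hx, ht⟩

lemma isParam (hw : IsSolution w₀ w) : IsParam (lenL w) where
  pos t ht := (hw.isUnitProfile ht).paramL_pos
  continuousOn := by
    have hnum : ContinuousOn (fun t => ∫ x in Ioi (0 : ℝ), x ^ (-(2 / 3) : ℝ) * w x t) (Ici 0) := by
      intro t ht
      have hbd : ∀ᶠ s in 𝓝[Ici 0] t, w 0 s ≤ w 0 t + 1 :=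
        ((hw.continuousOn_time le_rfl t ht).eventually_lt_const
          (show w 0 t < w 0 t + 1 by linarith)).mono fun s hs => hs.le
      refine continuousWithinAt_of_dominated (bound := singularBound (w 0 t + 1)) ?_ ?_
        (integrableOn_singularBound _) ?_
      · filter_upwards [self_mem_nhdsWithin] with s hs
        exact (hw.isUnitProfile hs).aestronglyMeasurable_singular
      · filter_upwards [self_mem_nhdsWithin, hbd] with s hs hsb
        filter_upwards [self_mem_ae_restrict measurableSet_Ioi] with x hx
        exact (hw.isUnitProfile hs).singular_le hsb hx
      · filter_upwards [self_mem_ae_restrict measurableSet_Ioi] with x hx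
        exact continuousWithinAt_const.mul (hw.continuousOn_time (le_of_lt hx) t ht)
    exact (((hnum.const_mul (1 / 3)).div (hw.continuousOn_time le_rfl)
      fun t ht => (hw.isUnitProfile ht).zero_pos.ne').pow 3)

/-- A solution is constant along characteristics. -/
lemma eq_initial (hw : IsSolution w₀ w) {t s : ℝ} {X : ℝ → ℝ} (hX : IsChar (lenL w) t X)
    (hs : s ∈ Icc 0 t) : w (X s) s = w₀ (X 0) := by
  have hX' := hX.restrict hs
  have h0 : (0 : ℝ) ∈ Icc 0 s := ⟨le_rfl, hs.1⟩
  rw [← hw.initial _ (hX'.nonneg' h0)]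
  refine eq_of_hasDerivAt_zero_of_pos (f := fun r => w (X r) r) hs.1 ?_ ?_ ?_
  · exact hw.continuousOn.comp (f := fun r => (X r, r)) (hX'.continuousOn.prodMk continuousOn_id)
      fun r hr => ⟨hX'.nonneg' hr, hr.1⟩
  · exact fun r hr => hw.nonneg _ _ (hX'.nonneg' hr) hr.1
  · intro r hr hpos
    have hxr := hX'.pos r ⟨hr.1.le, hr.2⟩
    have hF := (hw.differentiableAt (X r) r hxr hr.1 hpos).hasFDerivAt
    set F := fderiv ℝ (Function.uncurry w) (X r, r)
    have d1 : HasDerivAt (fun q => w (X q) q) (F (cbrt (X r / lenL w r) - 1, 1)) r :=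
      hF.comp_hasDerivAt (f := fun q => (X q, q)) r ((hX'.hasDerivAt r hr).prodMk (hasDerivAt_id r))
    have d2 : HasDerivAt (fun y => w y r) (F (1, 0)) (X r) :=
      hF.comp_hasDerivAt (f := fun y => (y, r)) (X r)
        ((hasDerivAt_id (X r)).prodMk (hasDerivAt_const _ _))
    have d3 : HasDerivAt (fun q => w (X r) q) (F (0, 1)) r :=
      hF.comp_hasDerivAt (f := fun q => (X r, q)) r
        ((hasDerivAt_const _ _).prodMk (hasDerivAt_id r))
    have heq := hw.equation (X r) r hxr hr.1 hpos
    rw [d2.deriv, d3.deriv] at heq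
    refine d1.congr_deriv ?_
    have e : ((cbrt (X r / lenL w r) - 1, 1) : ℝ × ℝ)
        = (cbrt (X r / lenL w r) - 1) • ((1, 0) : ℝ × ℝ) + ((0, 1) : ℝ × ℝ) := by simp
    rw [e, map_add, map_smul, heq, smul_eq_mul, lenL, cbrt]
    ring

lemma meanVolume_eq (hw : IsSolution w₀ w) {t : ℝ} (ht : 0 < t) :
    meanVolume w t = 1 / w 0 t := by
  have hu := hw.isUnitProfile ht.le
  have hc := hw.continuousOn_space ht.le
  have hd : ∀ x, 0 < x → 0 < w x t → DifferentiableAt ℝ (fun y => w y t) x := fun x hx hp =>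
    (hw.differentiableAt x t hx ht hp).comp (f := fun y => (y, t)) x (by fun_prop)
  unfold meanVolume density
  rw [hu.integral_mul_density hc hd, hu.integral_density hc hd]

end IsSolution

/-! ### Initial data with bounded beta function -/

/-- The mean residual volume `h / w = E[X - y | X > y]`. -/
def resid (w₀ : ℝ → ℝ) (y : ℝ) : ℝ := tailIntegral w₀ y / w₀ y

/-- A continuous unit profile with beta function `β` between `0` and `B`. The relation
`β = h'' h / (h')²` is written as the differential equation `w' = -β w / m` for `w`, where
`m = h / w`. -/
structure HasBeta (w₀ β : ℝ → ℝ) (B : ℝ) : Prop where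
  unit : IsUnitProfile w₀
  continuousOn : ContinuousOn w₀ (Ici 0)
  one_le : 1 ≤ B
  beta_nonneg : ∀ y, 0 < y → 0 < w₀ y → 0 ≤ β y
  beta_le : ∀ y, 0 < y → 0 < w₀ y → β y ≤ B
  hasDerivAt : ∀ y, 0 < y → 0 < w₀ y → HasDerivAt w₀ (-(β y * w₀ y / resid w₀ y)) y

lemma IsUnitProfile.tailIntegral_eq {u : ℝ → ℝ} (hu : IsUnitProfile u) {y z : ℝ} (hy : 0 ≤ y)
    (hyz : y ≤ z) : tailIntegral u y = (∫ x in y..z, u x) + tailIntegral u z := by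
  rw [tailIntegral, tailIntegral, intervalIntegral.integral_of_le hyz, ← setIntegral_union
    (Ioc_disjoint_Ioi le_rfl) measurableSet_Ioi, Ioc_union_Ioi_eq_Ioi hyz]
  · exact hu.integrable.mono_set (Ioc_subset_Ioi_self.trans (Ioi_subset_Ioi hy))
  · exact hu.integrable.mono_set (Ioi_subset_Ioi (hy.trans hyz))

lemma IsUnitProfile.tailIntegral_nonneg {u : ℝ → ℝ} (hu : IsUnitProfile u) {y : ℝ} (hy : 0 ≤ y) :
    0 ≤ tailIntegral u y :=
  setIntegral_nonneg measurableSet_Ioi fun x hx => hu.nonneg x (hy.trans (le_of_lt hx))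

lemma IsUnitProfile.tailIntegral_pos {u : ℝ → ℝ} (hu : IsUnitProfile u)
    (hc : ContinuousOn u (Ici 0)) {y : ℝ} (hy : 0 ≤ y) (h : 0 < u y) : 0 < tailIntegral u y := by
  have h1 : ∀ᶠ z in 𝓝[>] y, 0 < u z :=
    ((hc y hy).mono (Ioi_subset_Ici hy)).eventually_const_lt h
  obtain ⟨z, hz, hyz⟩ := (h1.and self_mem_nhdsWithin).exists
  have hyz : y < z := hyz
  rw [hu.tailIntegral_eq hy hyz.le]
  have h2 : ∫ x in y..z, u z ≤ ∫ x in y..z, u x := by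
    refine intervalIntegral.integral_mono_on hyz.le (by simp)
      ((hc.mono fun x hx => hy.trans hx.1).intervalIntegrable_of_Icc hyz.le) fun x hx => ?_
    exact hu.antitone (mem_Ici.2 (hy.trans hx.1)) (mem_Ici.2 (hy.trans hyz.le)) hx.2
  rw [intervalIntegral.integral_const, smul_eq_mul] at h2
  have := hu.tailIntegral_nonneg (hy.trans hyz.le)
  have : 0 < (z - y) * u z := mul_pos (by linarith) hz
  linarith

lemma IsUnitProfile.tailIntegral_eqOn {u : ℝ → ℝ} (hu : IsUnitProfile u) :
    EqOn (tailIntegral u) (fun x => 1 - ∫ y in (0 : ℝ)..x, u y) (Ici 0) := fun x hx => by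
  have := hu.tailIntegral_eq le_rfl hx
  have h1 : tailIntegral u 0 = 1 := hu.mass
  simp only
  linarith

lemma IsUnitProfile.hasDerivWithinAt_tailIntegral {u : ℝ → ℝ} (hu : IsUnitProfile u)
    (hc : ContinuousOn u (Ici 0)) {y : ℝ} (hy : 0 ≤ y) :
    HasDerivWithinAt (tailIntegral u) (-u y) (Ici 0) y := by
  have h1 : HasDerivWithinAt (fun x => ∫ z in (0 : ℝ)..x, u z) (u y) (Icc 0 (y + 1)) y := by
    have hy' : y ∈ Icc 0 (y + 1) := ⟨hy, by linarith⟩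
    have : Fact (y ∈ Icc 0 (y + 1)) := ⟨hy'⟩
    have hcI : ContinuousOn u (Icc 0 (y + 1)) := hc.mono Icc_subset_Ici_self
    refine intervalIntegral.integral_hasDerivWithinAt_right
      ((hc.mono Icc_subset_Ici_self).intervalIntegrable_of_Icc hy) (t := Icc 0 (y + 1))
      (hcI.stronglyMeasurableAtFilter_nhdsWithin measurableSet_Icc y) (hcI y hy')
  have h2 : HasDerivWithinAt (fun x => ∫ z in (0 : ℝ)..x, u z) (u y) (Ici 0) y := by
    refine h1.mono_of_mem_nhdsWithin (mem_nhdsWithin.2 ⟨Iio (y + 1), isOpen_Iio, by simp, ?_⟩)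
    rintro z ⟨hz1, hz2⟩
    exact ⟨hz2, le_of_lt hz1⟩
  exact (h2.const_sub 1).congr (fun x hx => hu.tailIntegral_eqOn hx) (hu.tailIntegral_eqOn hy)

/-- The interval `[0, ‖X‖_∞)` is the set where the profile is positive. -/
lemma mem_domainUpTo_iff {u : ℝ → ℝ} (hu : IsUnitProfile u) (hc : ContinuousOn u (Ici 0)) {y : ℝ} :
    y ∈ domainUpTo (supportEnd u) ↔ 0 ≤ y ∧ 0 < u y := by
  constructor
  · rintro ⟨hy, h⟩
    refine ⟨hy, ?_⟩
    obtain ⟨_, ⟨x, ⟨hx, hux⟩, rfl⟩, hyx⟩ := lt_sSup_iff.1 h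
    exact hux.trans_le (hu.antitone hy hx (EReal.coe_lt_coe_iff.1 hyx).le)
  · rintro ⟨hy, h⟩
    refine ⟨hy, ?_⟩
    have h1 : ∀ᶠ z in 𝓝[>] y, 0 < u z :=
      ((hc y hy).mono (Ioi_subset_Ici hy)).eventually_const_lt h
    obtain ⟨z, hz, hyz⟩ := (h1.and self_mem_nhdsWithin).exists
    have hyz : y < z := hyz
    exact (EReal.coe_lt_coe_iff.2 hyz).trans_le (le_sSup ⟨z, ⟨hy.trans hyz.le, hz⟩, rfl⟩)

lemma IsInitialDatum.hasBeta {w₀ β : ℝ → ℝ} {B : ℝ} (h : IsInitialDatum w₀)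
    (hu : IsUnitProfile w₀) (hc : ContinuousOn w₀ (Ici 0)) (hB : 1 ≤ B)
    (hβ : EqOn (betaFun w₀) β (domainUpTo (supportEnd w₀)))
    (hle : ∀ y ∈ domainUpTo (supportEnd w₀), β y ≤ B) : HasBeta w₀ β B := by
  have key : ∀ y, 0 < y → 0 < w₀ y →
      HasDerivAt w₀ (-(β y * w₀ y / resid w₀ y)) y ∧ 0 ≤ β y := by
    intro y hy hpos
    have hmem := (mem_domainUpTo_iff hu hc).2 ⟨hy.le, hpos⟩
    have ht := hu.tailIntegral_pos hc hy.le hpos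
    have hnhds : domainUpTo (supportEnd w₀) ∈ 𝓝 y := by
      have h1 : ∀ᶠ z in 𝓝 y, 0 < w₀ z :=
        (hc.continuousAt (Ici_mem_nhds hy)).eventually_const_lt hpos
      filter_upwards [h1, Ioi_mem_nhds hy] with z hz1 hz2
      exact (mem_domainUpTo_iff hu hc).2 ⟨le_of_lt hz2, hz1⟩
    have hcd : ContDiffAt ℝ 2 (tailIntegral w₀) y := (h.contDiff y hmem).contDiffAt hnhds
    have hde : deriv (tailIntegral w₀) =ᶠ[𝓝 y] fun z => -w₀ z := by
      filter_upwards [Ioi_mem_nhds hy] with z hz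
      exact ((hu.hasDerivWithinAt_tailIntegral hc (le_of_lt hz)).hasDerivAt
        (Ici_mem_nhds hz)).deriv
    have hdd : DifferentiableAt ℝ w₀ y := by
      have h1 : ContDiffAt ℝ 1 (deriv (tailIntegral w₀)) y :=
        hcd.derivWithin (m := 1) (by norm_num)
      have := (h1.differentiableAt (by norm_num)).congr_of_eventuallyEq hde.symm
      simpa using this.neg
    have hit : iteratedDerivWithin 2 (tailIntegral w₀) (Ici 0) y = -deriv w₀ y := by
      rw [iteratedDerivWithin_succ]
      have : EqOn (iteratedDerivWithin 1 (tailIntegral w₀) (Ici 0)) (fun z => -w₀ z) (Ici 0) := by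
        intro z hz
        rw [iteratedDerivWithin_one]
        exact (hu.hasDerivWithinAt_tailIntegral hc hz).derivWithin
          (uniqueDiffOn_Ici 0 z hz)
      rw [derivWithin_congr this (this hy.le), derivWithin_of_mem_nhds (Ici_mem_nhds hy)]
      exact deriv.fun_neg
    have hb : β y = -deriv w₀ y * tailIntegral w₀ y / (-w₀ y) ^ 2 := by
      rw [← hβ hmem, betaFun, hit, (hu.hasDerivWithinAt_tailIntegral hc hy.le).derivWithin
        (uniqueDiffOn_Ici 0 y hy.le)]
    refine ⟨hdd.hasDerivAt.congr_deriv ?_, ?_⟩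
    · rw [hb, resid]; field_simp
    · rw [hb]
      have := hu.deriv_nonpos hy
      have : 0 ≤ -deriv w₀ y := by linarith
      positivity
  exact ⟨hu, hc, hB, fun y hy hp => (key y hy hp).2,
    fun y hy hp => hle y ((mem_domainUpTo_iff hu hc).2 ⟨hy.le, hp⟩),
    fun y hy hp => (key y hy hp).1⟩

namespace HasBeta

variable {w₀ β : ℝ → ℝ} {B : ℝ}

lemma pos_of_le (h : HasBeta w₀ β B) {y z : ℝ} (hy : 0 ≤ y) (hyz : y ≤ z) (hz : 0 < w₀ z) :
    0 < w₀ y := hz.trans_le (h.unit.antitone hy (mem_Ici.2 (hy.trans hyz)) hyz)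

lemma tail_pos (h : HasBeta w₀ β B) {y : ℝ} (hy : 0 ≤ y) (hp : 0 < w₀ y) :
    0 < tailIntegral w₀ y := h.unit.tailIntegral_pos h.continuousOn hy hp

lemma resid_pos (h : HasBeta w₀ β B) {y : ℝ} (hy : 0 ≤ y) (hp : 0 < w₀ y) : 0 < resid w₀ y :=
  div_pos (h.tail_pos hy hp) hp

lemma tail_eq (_ : HasBeta w₀ β B) {y : ℝ} (hp : 0 < w₀ y) :
    tailIntegral w₀ y = resid w₀ y * w₀ y := by rw [resid]; field_simp

lemma continuousOn_resid (h : HasBeta w₀ β B) : ContinuousOn (resid w₀) {y | 0 ≤ y ∧ 0 < w₀ y} := by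
  refine ContinuousOn.div (fun y hy => ?_) (h.continuousOn.mono fun y hy => hy.1)
    fun y hy => hy.2.ne'
  exact ((h.unit.hasDerivWithinAt_tailIntegral h.continuousOn hy.1).continuousWithinAt).mono
    fun y hy => hy.1

lemma hasDerivAt_resid (h : HasBeta w₀ β B) {y : ℝ} (hy : 0 < y) (hp : 0 < w₀ y) :
    HasDerivAt (resid w₀) (β y - 1) y := by
  have h1 := (h.unit.hasDerivWithinAt_tailIntegral h.continuousOn hy.le).hasDerivAt
    (Ici_mem_nhds hy)
  refine (h1.div (h.hasDerivAt y hy hp) hp.ne').congr_deriv ?_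
  have hr := h.resid_pos hy.le hp
  rw [h.tail_eq hp]
  field_simp
  ring

/-- Monotonicity on an interval of the support from the sign of the derivative. -/
lemma le_of_deriv_nonneg (h : HasBeta w₀ β B) {f f' : ℝ → ℝ} {y z : ℝ} (hy : 0 ≤ y) (hyz : y ≤ z)
    (hz : 0 < w₀ z) (hf : ContinuousOn f (Icc y z))
    (hd : ∀ x, 0 < x → y < x → x < z → 0 < w₀ x → HasDerivAt f (f' x) x)
    (hn : ∀ x, 0 < x → y < x → x < z → 0 < w₀ x → 0 ≤ f' x) : f y ≤ f z := by
  have := mul_sub_le_sub_of_le_deriv (c := 0) hyz hf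
    (fun x hx => hd x (hy.trans_lt hx.1) hx.1 hx.2
      (h.pos_of_le (hy.trans hx.1.le) hx.2.le hz))
    (fun x hx => hn x (hy.trans_lt hx.1) hx.1 hx.2 (h.pos_of_le (hy.trans hx.1.le) hx.2.le hz))
  linarith

lemma continuousOn_resid_Icc (h : HasBeta w₀ β B) {y z : ℝ} (hy : 0 ≤ y) (hz : 0 < w₀ z) :
    ContinuousOn (resid w₀) (Icc y z) :=
  h.continuousOn_resid.mono fun _ hx => ⟨hy.trans hx.1, h.pos_of_le (hy.trans hx.1) hx.2 hz⟩

lemma resid_le (h : HasBeta w₀ β B) {y z : ℝ} (hy : 0 ≤ y) (hyz : y ≤ z) (hz : 0 < w₀ z) :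
    resid w₀ z ≤ resid w₀ y + B * (z - y) := by
  have := h.le_of_deriv_nonneg (f := fun x => B * x - resid w₀ x) (f' := fun x => B - (β x - 1))
    hy hyz hz (ContinuousOn.sub (by fun_prop) (h.continuousOn_resid_Icc hy hz))
    (fun x hx _ _ hp => (((hasDerivAt_id x).const_mul B).sub (h.hasDerivAt_resid hx hp)).congr_deriv
      (by simp))
    (fun x hx _ _ hp => by linarith [h.beta_le x hx hp])
  linarith

lemma le_resid (h : HasBeta w₀ β B) {y z : ℝ} (hy : 0 ≤ y) (hyz : y ≤ z) (hz : 0 < w₀ z) :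
    resid w₀ y - (z - y) ≤ resid w₀ z := by
  have := h.le_of_deriv_nonneg (f := fun x => x + resid w₀ x) (f' := fun x => 1 + (β x - 1))
    hy hyz hz (ContinuousOn.add (by fun_prop) (h.continuousOn_resid_Icc hy hz))
    (fun x hx _ _ hp => (hasDerivAt_id x).add (h.hasDerivAt_resid hx hp))
    (fun x hx _ _ hp => by linarith [h.beta_nonneg x hx hp])
  linarith

/-- The support extends beyond `y + κ m y` for every `κ < 1`. -/
lemma pos_add (h : HasBeta w₀ β B) {y κ : ℝ} (hy : 0 ≤ y) (hp : 0 < w₀ y) (hκ : 0 ≤ κ)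
    (hκ1 : κ < 1) : 0 < w₀ (y + κ * resid w₀ y) := by
  have hr := h.resid_pos hy hp
  have hk : 0 ≤ κ * resid w₀ y := by positivity
  set z := y + κ * resid w₀ y with hz
  have hz0 : 0 ≤ z := by linarith
  have hyz : y ≤ z := by linarith
  rcases (h.unit.nonneg z hz0).eq_or_lt with h0 | h0
  · exfalso
    have e := h.unit.tailIntegral_eq hy hyz
    have e2 : tailIntegral w₀ z = 0 := by
      refine setIntegral_eq_zero_of_forall_eq_zero fun x hx => ?_
      have hx' : z < x := hx
      exact le_antisymm ((h.unit.antitone hz0 (mem_Ici.2 (hz0.trans hx'.le)) hx'.le).trans h0.ge)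
        (h.unit.nonneg x (hz0.trans hx'.le))
    have e3 : ∫ x in y..z, w₀ x ≤ ∫ x in y..z, w₀ y := by
      refine intervalIntegral.integral_mono_on hyz
        ((h.continuousOn.mono fun x hx => hy.trans hx.1).intervalIntegrable_of_Icc hyz) (by simp)
        fun x hx => ?_
      exact h.unit.antitone hy (mem_Ici.2 (hy.trans hx.1)) hx.1
    rw [intervalIntegral.integral_const, smul_eq_mul] at e3
    rw [h.tail_eq hp] at e
    have : (z - y) * w₀ y = κ * (resid w₀ y * w₀ y) := by rw [hz]; ring
    have := mul_pos hr hp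
    nlinarith
  · exact h0

/-- Since `β ≤ B`, the profile does not drop faster than a power: on the scale of the mean residual
volume, `w (y + κ m) ≥ (1 - κ)^B w y`. -/
lemma exp_mul_le (h : HasBeta w₀ β B) {y κ : ℝ} (hy : 0 ≤ y) (hp : 0 < w₀ y) (hκ : 0 ≤ κ)
    (hκ1 : κ < 1) : Real.exp (B * Real.log (1 - κ)) * w₀ y ≤ w₀ (y + κ * resid w₀ y) := by
  have hr := h.resid_pos hy hp
  have hk : 0 ≤ κ * resid w₀ y := by positivity
  have hzp := h.pos_add hy hp hκ hκ1
  have hk1 : κ * resid w₀ y < resid w₀ y := by nlinarith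
  set z := y + κ * resid w₀ y with hz
  have hyz : y ≤ z := by linarith
  set R := y + resid w₀ y with hR
  have hzR : z < R := by linarith
  have hw : ∀ x ∈ Icc y z, 0 < w₀ x := fun x hx => h.pos_of_le (hy.trans hx.1) hx.2 hzp
  have := h.le_of_deriv_nonneg (f := fun x => Real.log (w₀ x) - B * Real.log (R - x))
    (f' := fun x => -(β x * w₀ x / resid w₀ x) / w₀ x - B * (-1 / (R - x))) hy hyz hzp
    (((h.continuousOn.mono fun x hx => hy.trans hx.1).log fun x hx => (hw x hx).ne').sub
      (ContinuousOn.mul continuousOn_const (ContinuousOn.log (by fun_prop)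
        fun x hx => by have := hx.2; have : 0 < R - x := by linarith
                       exact this.ne')))
    (fun x hx _ hxz hp' => by
      have hne : R - x ≠ 0 := by have : 0 < R - x := by linarith
                                 exact this.ne'
      refine ((h.hasDerivAt x hx hp').log hp'.ne').sub (HasDerivAt.const_mul B ?_)
      exact ((hasDerivAt_id x).const_sub R).log hne)
    (fun x hx hyx hxz hp' => by
      have hRx : 0 < R - x := by linarith
      have h1 := h.le_resid hy hyx.le hp'
      have h2 : R - x ≤ resid w₀ x := by linarith
      have h3 := h.beta_le x hx hp'
      have e : -(β x * w₀ x / resid w₀ x) / w₀ x - B * (-1 / (R - x))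
          = B / (R - x) - β x / resid w₀ x := by
        have := h.resid_pos hx.le hp'
        field_simp; ring
      rw [e]
      have : β x / resid w₀ x ≤ B / (R - x) :=
        div_le_div₀ (by linarith [h.one_le]) h3 hRx h2
      linarith)
  have e1 : R - y = resid w₀ y := by rw [hR]; ring
  have e2 : R - z = (1 - κ) * resid w₀ y := by rw [hR, hz]; ring
  rw [e1, e2, Real.log_mul (by linarith) hr.ne'] at this
  rw [← Real.log_le_log_iff (mul_pos (Real.exp_pos _) hp) hzp,
    Real.log_mul (Real.exp_pos _).ne' hp.ne', Real.log_exp]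
  linarith

/-- A lower bound for `β` makes the profile decay on the scale of the mean residual volume. -/
lemma le_exp_mul (h : HasBeta w₀ β B) {y κ b : ℝ} (hy : 0 ≤ y) (hp : 0 < w₀ y) (hκ : 0 ≤ κ)
    (hκ1 : κ < 1) (hβ : ∀ x, y ≤ x → 0 < x → 0 < w₀ x → b ≤ β x) :
    w₀ (y + κ * resid w₀ y) ≤ Real.exp (-(b * κ / (1 + B * κ))) * w₀ y := by
  have hr := h.resid_pos hy hp
  have hk : 0 ≤ κ * resid w₀ y := by positivity
  have hzp := h.pos_add hy hp hκ hκ1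
  have hB := h.one_le
  set z := y + κ * resid w₀ y with hz
  have hyz : y ≤ z := by linarith
  have hBk : 0 < 1 + B * κ := by positivity
  have hw : ∀ x ∈ Icc y z, 0 < w₀ x := fun x hx => h.pos_of_le (hy.trans hx.1) hx.2 hzp
  set c := b / ((1 + B * κ) * resid w₀ y) with hc
  have := h.le_of_deriv_nonneg (f := fun x => -(Real.log (w₀ x) + c * x))
    (f' := fun x => -(-(β x * w₀ x / resid w₀ x) / w₀ x + c * 1)) hy hyz hzp
    (((h.continuousOn.mono fun x hx => hy.trans hx.1).log fun x hx => (hw x hx).ne').add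
      (by fun_prop)).neg
    (fun x hx _ _ hp' => (((h.hasDerivAt x hx hp').log hp'.ne').add
      ((hasDerivAt_id x).const_mul c)).neg)
    (fun x hx hyx hxz hp' => by
      have hrx := h.resid_pos hx.le hp'
      have e : -(-(β x * w₀ x / resid w₀ x) / w₀ x + c * 1) = β x / resid w₀ x - c := by
        field_simp; ring
      have h1 := h.resid_le hy hyx.le hp'
      have h2 : resid w₀ x ≤ (1 + B * κ) * resid w₀ y := by
        have : B * (x - y) ≤ B * (κ * resid w₀ y) :=
          mul_le_mul_of_nonneg_left (by linarith) (by linarith)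
        linarith
      have h3 : c ≤ β x / resid w₀ x :=
        div_le_div₀ (h.beta_nonneg x hx hp') (hβ x hyx.le hx hp') hrx h2
      rw [e]; linarith)
  have e1 : c * z - c * y = b * κ / (1 + B * κ) := by
    rw [hc, hz]; field_simp; ring
  rw [← Real.log_le_log_iff hzp (mul_pos (Real.exp_pos _) hp),
    Real.log_mul (Real.exp_pos _).ne' hp.ne', Real.log_exp]
  linarith

end HasBeta

/-! ### Concentration and short-time bounds -/

/-- The mean volume `1 / w(0, t)`, in the form in which it enters the estimates. -/
def mean (w : ℝ → ℝ → ℝ) (t : ℝ) : ℝ := 1 / w 0 t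

open Classical in
/-- A characteristic on `[0, t]` which ends at volume `x`. -/
def charTo (w : ℝ → ℝ → ℝ) (x t : ℝ) : ℝ → ℝ :=
  if h : ∃ X, IsChar (lenL w) t X ∧ X t = x then h.choose else 0

/-- The initial volume of the clusters which vanish at time `t`. -/
def label (w : ℝ → ℝ → ℝ) (t : ℝ) : ℝ := charTo w 0 t 0

/-- A solution whose initial datum has beta function `β ∈ [0, B]`. -/
structure IsEvolution (w₀ : ℝ → ℝ) (w : ℝ → ℝ → ℝ) (β : ℝ → ℝ) (B : ℝ) : Prop where
  sol : IsSolution w₀ w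
  data : HasBeta w₀ β B

/-- The fraction of clusters beyond half the mean residual volume is at least `2^{-B}`. -/
def fracB (B : ℝ) : ℝ := Real.exp (B * Real.log (1 - 1 / 2))

lemma fracB_pos (B : ℝ) : 0 < fracB B := Real.exp_pos _

lemma fracB_le_one {B : ℝ} (hB : 1 ≤ B) : fracB B ≤ 1 := by
  rw [fracB, Real.exp_le_one_iff]
  exact mul_nonpos_of_nonneg_of_nonpos (by linarith) (Real.log_nonpos (by norm_num) (by norm_num))

/-- A lower bound for the ratio of `L` and the mean volume. -/
def ratioB (B : ℝ) : ℝ := fracB B ^ 3 / 4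

lemma ratioB_pos (B : ℝ) : 0 < ratioB B := by have := fracB_pos B; rw [ratioB]; positivity

lemma ratioB_le_one {B : ℝ} (hB : 1 ≤ B) : ratioB B ≤ 1 := by
  have := pow_le_one₀ (fracB_pos B).le (fracB_le_one hB) (n := 3)
  rw [ratioB]; linarith

namespace IsSolution

variable {w₀ : ℝ → ℝ} {w : ℝ → ℝ → ℝ}

lemma charTo_spec (hw : IsSolution w₀ w) {x t : ℝ} (hx : 0 ≤ x) (ht : 0 ≤ t) :
    IsChar (lenL w) t (charTo w x t) ∧ charTo w x t t = x := by
  have h := exists_char hw.isParam ht hx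
  rw [charTo, dif_pos h]
  exact h.choose_spec

lemma isChar (hw : IsSolution w₀ w) {x t : ℝ} (hx : 0 ≤ x) (ht : 0 ≤ t) :
    IsChar (lenL w) t (charTo w x t) := (hw.charTo_spec hx ht).1

lemma charTo_self (hw : IsSolution w₀ w) {x t : ℝ} (hx : 0 ≤ x) (ht : 0 ≤ t) :
    charTo w x t t = x := (hw.charTo_spec hx ht).2

lemma apply_eq (hw : IsSolution w₀ w) {x t : ℝ} (hx : 0 ≤ x) (ht : 0 ≤ t) :
    w x t = w₀ (charTo w x t 0) := by
  have := hw.eq_initial (hw.isChar hx ht) ⟨ht, le_rfl⟩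
  rwa [hw.charTo_self hx ht] at this

lemma label_nonneg (hw : IsSolution w₀ w) {t : ℝ} (ht : 0 ≤ t) : 0 ≤ label w t :=
  (hw.isChar le_rfl ht).nonneg' ⟨le_rfl, ht⟩

lemma w₀_label (hw : IsSolution w₀ w) {t : ℝ} (ht : 0 ≤ t) : w₀ (label w t) = w 0 t :=
  (hw.apply_eq le_rfl ht).symm

lemma zero_pos (hw : IsSolution w₀ w) {t : ℝ} (ht : 0 ≤ t) : 0 < w 0 t :=
  (hw.isUnitProfile ht).zero_pos

lemma mean_pos (hw : IsSolution w₀ w) {t : ℝ} (ht : 0 ≤ t) : 0 < mean w t :=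
  one_div_pos.2 (hw.zero_pos ht)

lemma w₀_label' (hw : IsSolution w₀ w) {t : ℝ} (ht : 0 ≤ t) : w₀ (label w t) = 1 / mean w t := by
  rw [hw.w₀_label ht, mean, one_div_one_div]

lemma w₀_label_pos (hw : IsSolution w₀ w) {t : ℝ} (ht : 0 ≤ t) : 0 < w₀ (label w t) := by
  rw [hw.w₀_label ht]; exact hw.zero_pos ht

/-- The value at the origin at time `t` is carried at time `s` by the clusters which vanish at
time `t`. -/
lemma zero_eq (hw : IsSolution w₀ w) {s t : ℝ} (hs : 0 ≤ s) (hst : s ≤ t) :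
    w 0 t = w (charTo w 0 t s) s := by
  have ht := hs.trans hst
  rw [hw.eq_initial (hw.isChar le_rfl ht) ⟨hs, hst⟩, hw.apply_eq le_rfl ht]

lemma zero_antitone (hw : IsSolution w₀ w) {s t : ℝ} (hs : 0 ≤ s) (hst : s ≤ t) :
    w 0 t ≤ w 0 s := by
  have h := (hw.isChar le_rfl (hs.trans hst)).nonneg' ⟨hs, hst⟩
  rw [hw.zero_eq hs hst]
  exact hw.antitone s hs (mem_Ici.2 le_rfl) h h

lemma mean_mono (hw : IsSolution w₀ w) {s t : ℝ} (hs : 0 ≤ s) (hst : s ≤ t) :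
    mean w s ≤ mean w t :=
  one_div_le_one_div_of_le (hw.zero_pos (hs.trans hst)) (hw.zero_antitone hs hst)

lemma lenL_le (hw : IsSolution w₀ w) {t : ℝ} (ht : 0 ≤ t) : lenL w t ≤ mean w t :=
  (hw.isUnitProfile ht).paramL_le

lemma charTo_lt_charTo (hw : IsSolution w₀ w) {x y t s : ℝ} (hx : 0 ≤ x) (hxy : x < y)
    (ht : 0 ≤ t) (hs : s ∈ Icc 0 t) : charTo w x t s < charTo w y t s := by
  refine (hw.isChar hx ht).gap_pos hw.isParam (hw.isChar (hx.trans hxy.le) ht) ?_ hs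
  rwa [hw.charTo_self hx ht, hw.charTo_self (hx.trans hxy.le) ht]

/-- The label of the clusters vanishing at time `s` lies below every characteristic which is
still positive at that time. -/
lemma charTo_zero_lt (hw : IsSolution w₀ w) {X : ℝ → ℝ} {s r : ℝ} (hs : 0 ≤ s)
    (hX : IsChar (lenL w) s X) (hpos : 0 < X s) (hr : r ∈ Icc 0 s) : charTo w 0 s r < X r := by
  refine (hw.isChar le_rfl hs).gap_pos hw.isParam hX ?_ hr
  rwa [hw.charTo_self le_rfl hs]

/-- The map from volumes at time `t` to initial volumes is convex. -/
lemma charTo_convex (hw : IsSolution w₀ w) {x y z t : ℝ} (hx : 0 ≤ x) (hxy : x < y) (hyz : y < z)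
    (ht : 0 ≤ t) : (z - y) * (charTo w y t 0 - charTo w x t 0)
      ≤ (y - x) * (charTo w z t 0 - charTo w y t 0) := by
  have hy := hx.trans hxy.le
  have hz := hy.trans hyz.le
  have := (hw.isChar hx ht).gap_concave hw.isParam (hw.isChar hy ht) (hw.isChar hz ht)
    (by rwa [hw.charTo_self hx ht, hw.charTo_self hy ht])
    (by rwa [hw.charTo_self hy ht, hw.charTo_self hz ht]) ht
  rwa [hw.charTo_self hx ht, hw.charTo_self hy ht, hw.charTo_self hz ht] at this

end IsSolution

namespace IsEvolution

variable {w₀ : ℝ → ℝ} {w : ℝ → ℝ → ℝ} {β : ℝ → ℝ} {B : ℝ}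

/-- Clusters of half the mean volume at time `t` come from at most one mean residual volume beyond
the clusters vanishing at time `t`. By convexity the profile lies, beyond `Λ / 2`, below an affine
reparametrization of the tail of `w₀`, which would otherwise have too little mass. -/
lemma charTo_half_mean_le (h : IsEvolution w₀ w β B) {t : ℝ} (ht : 0 ≤ t) :
    charTo w (mean w t / 2) t 0 ≤ label w t + resid w₀ (label w t) := by
  have hw := h.sol
  have hΛ := hw.mean_pos ht
  have hN := hw.zero_pos ht
  have hu := hw.isUnitProfile ht
  set x₁ := mean w t / 2 with hx₁
  have hx₁0 : 0 < x₁ := by positivity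
  have hxN : x₁ * w 0 t = 1 / 2 := by rw [hx₁, mean]; field_simp
  set z := label w t with hz
  have hz0 : 0 ≤ z := hw.label_nonneg ht
  set y₁ := charTo w x₁ t 0 with hy₁
  have hzy : z < y₁ := hw.charTo_lt_charTo le_rfl hx₁0 ht ⟨le_rfl, ht⟩
  set σ := (y₁ - z) / x₁ with hσ
  have hσ0 : 0 < σ := div_pos (by linarith) hx₁0
  have hσx : σ * x₁ = y₁ - z := by rw [hσ]; field_simp
  have hc := hw.continuousOn_space ht
  have hw₀c := h.data.continuousOn
  have hle : ∀ x, x₁ ≤ x → w x t ≤ w₀ (z + σ * x) := by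
    intro x hx
    have hx0 := hx₁0.le.trans hx
    rw [hw.apply_eq hx0 ht]
    have hzσ : 0 ≤ z + σ * x := by positivity
    have : z + σ * x ≤ charTo w x t 0 := by
      rcases hx.eq_or_lt with rfl | hlt
      · rw [hσx, ← hy₁]; linarith
      · have := hw.charTo_convex le_rfl hx₁0 hlt ht
        have e : charTo w 0 t 0 = z := rfl
        rw [← hy₁, sub_zero, e, ← hσx] at this
        have h2 : (x - x₁) * σ ≤ charTo w x t 0 - y₁ := by
          refine le_of_mul_le_mul_left ?_ hx₁0
          linarith
        linarith
    exact h.data.unit.antitone hzσ (mem_Ici.2 (hzσ.trans this)) this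
  have hbound : ∀ X, x₁ ≤ X → ∫ x in (0 : ℝ)..X, w x t ≤ 1 / 2 + σ⁻¹ * tailIntegral w₀ z := by
    intro X hX
    have hX0 := hx₁0.le.trans hX
    have i1 : IntervalIntegrable (fun x => w x t) volume 0 x₁ :=
      (hc.mono fun x hx => hx.1).intervalIntegrable_of_Icc hx₁0.le
    have i2 : IntervalIntegrable (fun x => w x t) volume x₁ X :=
      (hc.mono fun x hx => hx₁0.le.trans hx.1).intervalIntegrable_of_Icc hX
    have i3 : IntervalIntegrable (fun x => w₀ (z + σ * x)) volume x₁ X := by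
      refine ContinuousOn.intervalIntegrable_of_Icc hX
        (hw₀c.comp (f := fun x => z + σ * x) (by fun_prop) fun x hx => ?_)
      have : 0 ≤ σ * x := mul_nonneg hσ0.le (hx₁0.le.trans hx.1)
      exact mem_Ici.2 (by linarith)
    rw [← intervalIntegral.integral_add_adjacent_intervals i1 i2]
    have e1 : ∫ x in (0 : ℝ)..x₁, w x t ≤ ∫ x in (0 : ℝ)..x₁, w 0 t :=
      intervalIntegral.integral_mono_on hx₁0.le i1 (by simp) fun x hx =>
        hu.antitone (mem_Ici.2 le_rfl) hx.1 hx.1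
    rw [intervalIntegral.integral_const, smul_eq_mul, sub_zero, hxN] at e1
    have e2 : ∫ x in x₁..X, w x t ≤ ∫ x in x₁..X, w₀ (z + σ * x) :=
      intervalIntegral.integral_mono_on hX i2 i3 fun x hx => hle x hx.1
    rw [intervalIntegral.integral_comp_add_mul _ hσ0.ne', smul_eq_mul] at e2
    have hm : z + σ * x₁ ≤ z + σ * X := by
      have := mul_le_mul_of_nonneg_left hX hσ0.le; linarith
    have hσx0 : 0 ≤ σ * x₁ := by positivity
    have e3 := h.data.unit.tailIntegral_eq (y := z) (z := z + σ * x₁) hz0 (by linarith)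
    have e4 := h.data.unit.tailIntegral_eq (by linarith) hm
    have e5 := h.data.unit.tailIntegral_nonneg (y := z + σ * X) (by linarith)
    have e6 : 0 ≤ ∫ x in z..(z + σ * x₁), w₀ x :=
      intervalIntegral.integral_nonneg (by linarith) fun x hx =>
        h.data.unit.nonneg x (hz0.trans hx.1)
    have e7 : σ⁻¹ * ∫ x in (z + σ * x₁)..(z + σ * X), w₀ x ≤ σ⁻¹ * tailIntegral w₀ z :=
      mul_le_mul_of_nonneg_left (by linarith) (inv_pos.2 hσ0).le
    linarith
  have hlim : 1 ≤ 1 / 2 + σ⁻¹ * tailIntegral w₀ z :=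
    le_of_tendsto hu.tendsto_integral ((eventually_ge_atTop x₁).mono hbound)
  rw [h.data.tail_eq (hw.w₀_label_pos ht), hw.w₀_label ht] at hlim
  have h2 : σ ≤ 2 * (resid w₀ z * w 0 t) := by
    have := mul_le_mul_of_nonneg_left hlim hσ0.le
    rw [mul_add, mul_inv_cancel_left₀ hσ0.ne'] at this
    linarith
  have h3 : σ * x₁ ≤ 2 * (resid w₀ z * w 0 t) * x₁ := mul_le_mul_of_nonneg_right h2 hx₁0.le
  have h4 : 2 * (resid w₀ z * w 0 t) * x₁ = resid w₀ z := by
    linear_combination 2 * resid w₀ z * hxN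
  linarith

/-- At every time the fraction of clusters larger than a quarter of the mean volume is at least
`2^{-B}`. -/
lemma fracB_mul_le (h : IsEvolution w₀ w β B) {t : ℝ} (ht : 0 ≤ t) :
    fracB B * w 0 t ≤ w (mean w t / 4) t := by
  have hw := h.sol
  have hΛ := hw.mean_pos ht
  have h1 := h.charTo_half_mean_le ht
  have h2 := hw.charTo_convex (x := 0) (y := mean w t / 4) (z := mean w t / 2) le_rfl
    (by linarith) (by linarith) ht
  have e : charTo w 0 t 0 = label w t := rfl
  rw [e] at h2
  set y := charTo w (mean w t / 4) t 0 with hy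
  have h3 : y ≤ label w t + 1 / 2 * resid w₀ (label w t) := by
    have : (mean w t / 4) * (y - label w t)
        ≤ (mean w t / 4) * (charTo w (mean w t / 2) t 0 - y) := by linarith
    have := le_of_mul_le_mul_left this (by positivity)
    linarith
  have hz0 := hw.label_nonneg ht
  have hp := hw.w₀_label_pos ht
  have hr := h.data.resid_pos hz0 hp
  have h4 := h.data.exp_mul_le hz0 hp (κ := 1 / 2) (by norm_num) (by norm_num)
  rw [hw.apply_eq (x := mean w t / 4) (by positivity) ht, ← hy, ← hw.w₀_label ht]
  have hy0 : 0 ≤ y := (hw.isChar (by positivity) ht).nonneg' ⟨le_rfl, ht⟩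
  exact h4.trans (h.data.unit.antitone hy0 (mem_Ici.2 (by positivity)) h3)

lemma ratioB_mul_le (h : IsEvolution w₀ w β B) {t : ℝ} (ht : 0 ≤ t) :
    ratioB B * mean w t ≤ lenL w t := by
  have hΛ := h.sol.mean_pos ht
  have h1 := (h.sol.isUnitProfile ht).le_rootL (X := mean w t / 4) (by positivity)
    (h.fracB_mul_le ht)
  have h2 := pow_le_pow_left₀ (mul_nonneg (fracB_pos B).le
    (Real.rpow_nonneg (by positivity) _)) h1 3
  have e : ((mean w t / 4) ^ (1 / 3 : ℝ)) ^ 3 = mean w t / 4 := cbrt_pow (by positivity)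
  rw [mul_pow, e] at h2
  rw [lenL, paramL_eq, ratioB]
  linarith

/-- Clusters which still live for some time are not small. -/
lemma min_le_charTo_zero (h : IsEvolution w₀ w β B) {s t : ℝ} (hs : 0 ≤ s) (hst : s ≤ t) :
    min ((t - s) / 2) (ratioB B * mean w s / 8) ≤ charTo w 0 t s :=
  (h.sol.isChar le_rfl (hs.trans hst)).half_sub_le h.sol.isParam hs hst fun _ hr =>
    (mul_le_mul_of_nonneg_left (h.sol.mean_mono hs hr.1) (ratioB_pos B).le).trans
      (h.ratioB_mul_le (hs.trans hr.1))

end IsEvolution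

/-! ### Recurrence of fast windows -/

/-- Times `t₀ = 0`, `t_{n+1} = t_n + Λ(t_n) / 4`. -/
def winTime (w : ℝ → ℝ → ℝ) : ℕ → ℝ
  | 0 => 0
  | n + 1 => winTime w n + mean w (winTime w n) / 4

/-- The initial volume of the clusters which vanish at time `t_n`. -/
def winLabel (w : ℝ → ℝ → ℝ) (n : ℕ) : ℝ := label w (winTime w n)

/-- The mean volume at time `t_n`. -/
def winMean (w : ℝ → ℝ → ℝ) (n : ℕ) : ℝ := mean w (winTime w n)

/-- A time window is fast if the clusters vanishing in it occupied initially at least the fraction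
`ε` of the mean residual volume. -/
def IsFast (w₀ : ℝ → ℝ) (w : ℝ → ℝ → ℝ) (ε : ℝ) (k : ℕ) : Prop :=
  ε * resid w₀ (winLabel w k) ≤ winLabel w (k + 1) - winLabel w k

namespace IsSolution

variable {w₀ : ℝ → ℝ} {w : ℝ → ℝ → ℝ}

lemma winTime_nonneg (hw : IsSolution w₀ w) : ∀ n, 0 ≤ winTime w n
  | 0 => le_rfl
  | n + 1 => by
    have h := hw.winTime_nonneg n
    have := hw.mean_pos h
    rw [winTime]; positivity

lemma winMean_pos (hw : IsSolution w₀ w) (n : ℕ) : 0 < winMean w n :=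
  hw.mean_pos (hw.winTime_nonneg n)

lemma winTime_succ (n : ℕ) : winTime w (n + 1) = winTime w n + winMean w n / 4 := rfl

lemma winTime_strictMono (hw : IsSolution w₀ w) : StrictMono (winTime w) :=
  strictMono_nat_of_lt_succ fun n => by
    rw [winTime_succ]; linarith [hw.winMean_pos n]

lemma winMean_mono (hw : IsSolution w₀ w) : Monotone (winMean w) := fun i _ hij =>
  hw.mean_mono (hw.winTime_nonneg i) (hw.winTime_strictMono.monotone hij)

lemma winLabel_nonneg (hw : IsSolution w₀ w) (n : ℕ) : 0 ≤ winLabel w n :=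
  hw.label_nonneg (hw.winTime_nonneg n)

lemma w₀_winLabel (hw : IsSolution w₀ w) (n : ℕ) : w₀ (winLabel w n) = 1 / winMean w n :=
  hw.w₀_label' (hw.winTime_nonneg n)

lemma w₀_winLabel_pos (hw : IsSolution w₀ w) (n : ℕ) : 0 < w₀ (winLabel w n) :=
  hw.w₀_label_pos (hw.winTime_nonneg n)

lemma charTo_zero_pos (hw : IsSolution w₀ w) {s t : ℝ} (hs : 0 ≤ s) (hst : s < t) :
    0 < charTo w 0 t s :=
  (hw.isChar le_rfl (hs.trans hst.le)).pos s ⟨hs, hst⟩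

/-- Characteristics which vanish later lie higher. -/
lemma charTo_zero_lt_charTo_zero (hw : IsSolution w₀ w) {r s t : ℝ} (hr : 0 ≤ r) (hrs : r ≤ s)
    (hst : s < t) : charTo w 0 s r < charTo w 0 t r :=
  hw.charTo_zero_lt (hr.trans hrs)
    ((hw.isChar le_rfl (hr.trans (hrs.trans hst.le))).restrict ⟨hr.trans hrs, hst.le⟩)
    (hw.charTo_zero_pos (hr.trans hrs) hst) ⟨hr, hrs⟩

lemma winLabel_strictMono (hw : IsSolution w₀ w) : StrictMono (winLabel w) := fun i _ hij =>
  hw.charTo_zero_lt_charTo_zero le_rfl (hw.winTime_nonneg i) (hw.winTime_strictMono hij)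

/-- Windows last at least a quarter of the mean volume at the start. -/
lemma mul_le_winTime_sub (hw : IsSolution w₀ w) (a : ℕ) :
    ∀ i : ℕ, i * winMean w a / 4 ≤ winTime w (a + i) - winTime w a
  | 0 => by simp
  | i + 1 => by
    have h1 := hw.mul_le_winTime_sub a i
    have h2 := hw.winMean_mono (Nat.le_add_right a i)
    have h3 : winTime w (a + (i + 1)) = winTime w (a + i) + winMean w (a + i) / 4 := rfl
    push_cast
    linarith

end IsSolution

/-- Constants for which a fast window is always followed by another fast window after at most
`p + m` windows. -/
structure IsThreshold (B ε : ℝ) (p m : ℕ) : Prop where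
  one_le_p : 1 ≤ p
  le_m : 60 / fracB B ≤ m
  contraction : 32 * (1 + 4 * p) * Real.exp (1 / ratioB B) < ratioB B * Real.exp (p / 24)
  pos : 0 < ε
  lt_one : ε < 1
  le_ratio : ε ≤ ratioB B / 8
  mul_le : B * ε ≤ 1
  mul_sum_le : 8 * ((p + m : ℕ) : ℝ) * ε ≤ 1
  pow_le_two : (1 + B * ε) ^ (p + m) ≤ 2
  pow_le : Real.exp (-(B * Real.log (1 - ε))) ^ (p + m) ≤ 128 / 125

lemma exists_isThreshold (B : ℝ) : ∃ ε p m, IsThreshold B ε p m := by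
  obtain ⟨m, hm⟩ := exists_nat_ge (60 / fracB B)
  have hr := ratioB_pos B
  have hp : ∀ᶠ p : ℕ in atTop,
      32 * (1 + 4 * p) * Real.exp (1 / ratioB B) < ratioB B * Real.exp ((p : ℝ) / 24) := by
    have h1 : Tendsto (fun x : ℝ => Real.exp x / x ^ 1) atTop atTop :=
      Real.tendsto_exp_div_pow_atTop 1
    have h2 : Tendsto (fun p : ℕ => (p : ℝ) / 24) atTop atTop :=
      tendsto_natCast_atTop_atTop.atTop_div_const (by norm_num)
    have h3 := (h1.comp h2).eventually_gt_atTop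
      (32 * 5 * 24 * Real.exp (1 / ratioB B) / ratioB B)
    filter_upwards [h3, eventually_ge_atTop 1] with p h3 hp
    have hp1 : (1 : ℝ) ≤ p := by exact_mod_cast hp
    simp only [Function.comp, pow_one] at h3
    rw [div_lt_div_iff₀ hr (by positivity)] at h3
    have he := Real.exp_pos (1 / ratioB B)
    have : 32 * (1 + 4 * p) * Real.exp (1 / ratioB B) ≤ 32 * (5 * p) * Real.exp (1 / ratioB B) := by
      refine mul_le_mul_of_nonneg_right ?_ he.le
      linarith
    linarith
  obtain ⟨p, hp, hp1⟩ := (hp.and (eventually_ge_atTop 1)).exists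
  have e1 : ∀ᶠ ε : ℝ in 𝓝 0, ε < 1 := eventually_lt_nhds one_pos
  have e2 : ∀ᶠ ε : ℝ in 𝓝 0, ε < ratioB B / 8 := eventually_lt_nhds (by positivity)
  have e3 : ∀ᶠ ε : ℝ in 𝓝 0, B * ε < 1 :=
    (Continuous.tendsto (by fun_prop) (0 : ℝ)).eventually_lt_const (by simp)
  have e4 : ∀ᶠ ε : ℝ in 𝓝 0, 8 * ((p + m : ℕ) : ℝ) * ε < 1 :=
    (Continuous.tendsto (by fun_prop) (0 : ℝ)).eventually_lt_const (by simp)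
  have e5 : ∀ᶠ ε : ℝ in 𝓝 0, (1 + B * ε) ^ (p + m) < 2 :=
    (Continuous.tendsto (by fun_prop) (0 : ℝ)).eventually_lt_const (by simp)
  have e6 : ∀ᶠ ε : ℝ in 𝓝 0, Real.exp (-(B * Real.log (1 - ε))) ^ (p + m) < 128 / 125 := by
    have hc : ContinuousAt (fun ε : ℝ => Real.exp (-(B * Real.log (1 - ε))) ^ (p + m)) 0 := by
      have : ContinuousAt (fun ε : ℝ => Real.log (1 - ε)) 0 :=
        ContinuousAt.log (by fun_prop) (by norm_num)
      exact ((Real.continuous_exp.continuousAt.comp (this.const_mul B).neg).pow _)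
    refine hc.eventually_lt_const ?_
    norm_num
  have hall := (((((e1.and e2).and e3).and e4).and e5).and e6).filter_mono
    (nhdsWithin_le_nhds (s := Ioi 0))
  obtain ⟨ε, ⟨⟨⟨⟨⟨h1, h2⟩, h3⟩, h4⟩, h5⟩, h6⟩, h0⟩ :=
    (hall.and self_mem_nhdsWithin).exists
  exact ⟨ε, p, m, hp1, hm, hp, h0, h1, h2.le, h3.le, h4.le, h5.le, h6.le⟩

namespace IsEvolution

variable {w₀ : ℝ → ℝ} {w : ℝ → ℝ → ℝ} {β : ℝ → ℝ} {B ε : ℝ} {p m : ℕ}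

lemma winResid_pos (h : IsEvolution w₀ w β B) (n : ℕ) : 0 < resid w₀ (winLabel w n) :=
  h.data.resid_pos (h.sol.winLabel_nonneg n) (h.sol.w₀_winLabel_pos n)

/-- The clusters vanishing at the end of the first window are initially not small. -/
lemma isFast_zero (h : IsEvolution w₀ w β B) (c : IsThreshold B ε p m) : IsFast w₀ w ε 0 := by
  have hw := h.sol
  have hΛ := hw.winMean_pos 0
  have ht := hw.winTime_nonneg 1
  have e0 : winTime w 0 = 0 := rfl
  have e1 : winTime w 1 = winMean w 0 / 4 := by
    have : winTime w 1 = winTime w 0 + winMean w 0 / 4 := rfl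
    rw [this, e0, zero_add]
  have hz0 : winLabel w 0 = 0 := hw.charTo_self le_rfl le_rfl
  have hr : resid w₀ (winLabel w 0) = winMean w 0 := by
    have h1 : tailIntegral w₀ 0 = 1 := h.data.unit.mass
    rw [hz0, resid, h1]
    have := hw.w₀_winLabel 0
    rw [hz0] at this
    rw [this, one_div_one_div]
  have h1 := h.min_le_charTo_zero le_rfl ht
  have hρ := ratioB_le_one h.data.one_le
  have h2 : ratioB B * winMean w 0 / 8
      ≤ min ((winTime w 1 - 0) / 2) (ratioB B * mean w 0 / 8) := by
    refine le_min ?_ le_rfl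
    rw [e1]
    have := mul_le_mul_of_nonneg_right hρ hΛ.le
    linarith
  have h3 : ratioB B * winMean w 0 / 8 ≤ winLabel w 1 := h2.trans h1
  rw [IsFast, hr, hz0, sub_zero]
  have := mul_le_mul_of_nonneg_right c.le_ratio hΛ.le
  linarith

/-- In a slow window the mean volume grows by a factor close to one. -/
lemma winMean_succ_le (h : IsEvolution w₀ w β B) (hε : 0 < ε) (hε1 : ε < 1) {j : ℕ}
    (hj : ¬ IsFast w₀ w ε j) :
    winMean w (j + 1) ≤ Real.exp (-(B * Real.log (1 - ε))) * winMean w j := by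
  have hw := h.sol
  have hz := hw.winLabel_nonneg j
  have hp := hw.w₀_winLabel_pos j
  have h1 := h.data.exp_mul_le hz hp hε.le hε1
  rw [IsFast, not_le] at hj
  have h2 := h.data.unit.antitone (hw.winLabel_nonneg (j + 1))
    (mem_Ici.2 (by linarith [hw.winLabel_nonneg (j + 1)]))
    (show winLabel w (j + 1) ≤ winLabel w j + ε * resid w₀ (winLabel w j) by linarith)
  have h3 := h1.trans h2
  rw [hw.w₀_winLabel, hw.w₀_winLabel, mul_one_div,
    div_le_div_iff₀ (hw.winMean_pos _) (hw.winMean_pos _), one_mul] at h3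
  rw [Real.exp_neg, inv_mul_eq_div, le_div_iff₀ (Real.exp_pos _)]
  linarith

section SlowRun

variable {a R : ℕ}

lemma winMean_le_of_slow (h : IsEvolution w₀ w β B) (hε : 0 < ε) (hε1 : ε < 1)
    (hs : ∀ j, a ≤ j → j < a + R → ¬ IsFast w₀ w ε j) (i : ℕ) (hi : i ≤ R) :
    winMean w (a + i) ≤ Real.exp (-(B * Real.log (1 - ε))) ^ i * winMean w a := by
  induction i with
  | zero => simp
  | succ i ih =>
    have h1 := h.winMean_succ_le hε hε1 (hs (a + i) (by omega) (by omega))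
    have h2 := mul_le_mul_of_nonneg_left (ih (by omega))
      (Real.exp_pos (-(B * Real.log (1 - ε)))).le
    rw [pow_succ', mul_assoc]
    exact h1.trans h2

lemma winResid_le_of_slow (h : IsEvolution w₀ w β B) (hε : 0 < ε)
    (hs : ∀ j, a ≤ j → j < a + R → ¬ IsFast w₀ w ε j) (i : ℕ) (hi : i ≤ R) :
    resid w₀ (winLabel w (a + i)) ≤ (1 + B * ε) ^ i * resid w₀ (winLabel w a) := by
  have hB := h.data.one_le
  induction i with
  | zero => simp
  | succ i ih =>
    have h1 := hs (a + i) (by omega) (by omega)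
    rw [IsFast, not_le] at h1
    have h2 := h.data.resid_le (h.sol.winLabel_nonneg (a + i))
      (h.sol.winLabel_strictMono (Nat.lt_succ_self (a + i))).le (h.sol.w₀_winLabel_pos _)
    have h3 := mul_le_mul_of_nonneg_left h1.le (show 0 ≤ B by linarith)
    have h4 := mul_le_mul_of_nonneg_left (ih (by omega)) (show 0 ≤ 1 + B * ε by positivity)
    rw [pow_succ', mul_assoc]
    have e : a + (i + 1) = (a + i).succ := rfl
    rw [e]
    linarith

lemma winLabel_sub_le_of_slow (h : IsEvolution w₀ w β B) (hε : 0 < ε)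
    (h2 : (1 + B * ε) ^ R ≤ 2) (hs : ∀ j, a ≤ j → j < a + R → ¬ IsFast w₀ w ε j) (i : ℕ)
    (hi : i ≤ R) :
    winLabel w (a + i) - winLabel w a ≤ i * (2 * ε * resid w₀ (winLabel w a)) := by
  have hB := h.data.one_le
  induction i with
  | zero => simp
  | succ i ih =>
    have h1 := hs (a + i) (by omega) (by omega)
    rw [IsFast, not_le] at h1
    have h3 := h.winResid_le_of_slow hε hs i (by omega)
    have h4 : (1 + B * ε) ^ i ≤ 2 :=
      (pow_le_pow_right₀ (by have : 0 ≤ B * ε := by positivity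
                             linarith) (by omega)).trans h2
    have h5 := mul_le_mul_of_nonneg_right h4 (h.winResid_pos a).le
    have h6 := mul_le_mul_of_nonneg_left (h3.trans h5) hε.le
    have h7 := ih (by omega)
    have e : a + (i + 1) = (a + i) + 1 := rfl
    rw [e]
    push_cast
    linarith

end SlowRun

/-- During a slow run the mean volume hardly changes, so a cluster larger than twice the mean keeps
growing. A cluster which at the end of the run is not too large was therefore at most of twice the
mean volume before. -/
lemma char_le_two_mul (h : IsEvolution w₀ w β B) {Λ s t x : ℝ} (hs : 0 ≤ s)
    (hst : s ≤ t) (hx : 0 ≤ x) (hmean : ∀ r ∈ Icc s t, mean w r ≤ 128 / 125 * Λ)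
    (hxt : x < 2 * Λ + 1 / 5 * (t - s)) : charTo w x t s ≤ 2 * Λ := by
  by_contra! hlt
  have hw := h.sol
  have ht := hs.trans hst
  have hX := hw.isChar hx ht
  have := line_le_of_lt_deriv (A := 2 * Λ) (c := 1 / 5) hst
    (hX.continuousOn.mono (Icc_subset_Icc_left hs))
    (fun r hr => hX.hasDerivAt r ⟨hs.trans_lt hr.1, hr.2⟩) hlt (fun r hr he => by
      have hr0 : 0 ≤ r := hs.trans hr.1.le
      have hL := hw.isParam.pos r hr0
      have h1 := (hw.lenL_le hr0).trans (hmean r ⟨hr.1.le, hr.2.le⟩)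
      have h2 : (5 / 4 : ℝ) ^ 3 ≤ charTo w x t r / lenL w r := by
        rw [le_div_iff₀ hL, he]
        have : 0 < r - s := by linarith [hr.1]
        norm_num
        linarith
      have h3 := cbrt_le (by norm_num) h2
      rw [cbrt_of_pow (by norm_num)] at h3
      linarith)
  rw [hw.charTo_self hx ht] at this
  linarith

/-- Small clusters separate exponentially fast. -/
lemma gap_contract (h : IsEvolution w₀ w β B) {Λ r s : ℝ} {X Y : ℝ → ℝ} (hΛ : 0 < Λ) (hr : 0 ≤ r)
    (hrs : r ≤ s) (hX : IsChar (lenL w) s X) (hY : IsChar (lenL w) s Y) (hXY : X s < Y s)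
    (hmean : ∀ q ∈ Icc r s, mean w q ≤ 2 * Λ) (hYle : ∀ q ∈ Icc r s, Y q ≤ 2 * Λ) :
    (Y r - X r) * Real.exp (1 / (6 * Λ) * (s - r)) ≤ Y s - X s := by
  have hw := h.sol
  refine hX.gap_le_of_le_rate hw.isParam hY hXY hr hrs le_rfl fun q hq => ?_
  have hq' : q ∈ Icc 0 s := ⟨hr.trans hq.1, hq.2⟩
  have h1 := cbrt_nonneg (hX.nonneg' hq')
  have h2 := cbrt_pos (hY.pos' (hX.nonneg.trans_lt hXY) hq')
  have h3 := cbrt_pos (hw.isParam.pos q hq'.1)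
  have h4 := cbrt_le (hX.nonneg' hq') (hX.gap_pos hw.isParam hY hXY hq').le
  have h5 := cbrt_le (hY.nonneg' hq') (hYle q hq)
  have h6 := cbrt_le (hw.isParam.pos q hq'.1).le ((hw.lenL_le hq'.1).trans (hmean q hq))
  have e := cbrt_pow (show (0 : ℝ) ≤ 2 * Λ by positivity)
  set c := cbrt (2 * Λ)
  have h7 : cbrt (X q) ^ 2 + cbrt (X q) * cbrt (Y q) + cbrt (Y q) ^ 2 ≤ 3 * c ^ 2 := by
    nlinarith
  rw [gapRate, div_div]
  refine one_div_le_one_div_of_le (by positivity) ?_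
  calc _ ≤ (3 * c ^ 2) * c := mul_le_mul h7 h6 h3.le (by positivity)
    _ = 6 * Λ := by linear_combination 3 * e

/-- A gap above which the upper characteristic is not small grows by a bounded factor in a time
comparable with the mean volume. -/
lemma gap_expand (h : IsEvolution w₀ w β B) {k : ℝ} {r s : ℝ} {X Y : ℝ → ℝ} (hk : 0 < k)
    (hr : 0 ≤ r) (hrs : r ≤ s) (hX : IsChar (lenL w) s X) (hY : IsChar (lenL w) s Y)
    (hXY : X s < Y s) (hL : ∀ q ∈ Icc r s, k ≤ lenL w q) (hYge : ∀ q ∈ Icc r s, k / 8 ≤ Y q) :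
    Y s - X s ≤ (Y r - X r) * Real.exp (4 / k * (s - r)) := by
  have hw := h.sol
  refine hX.gap_le_of_rate_le hw.isParam hY hXY hr hrs le_rfl fun q hq => ?_
  have hq' : q ∈ Icc 0 s := ⟨hr.trans hq.1, hq.2⟩
  have h1 := cbrt_nonneg (hX.nonneg' hq')
  have h4 : cbrt (k / 8) ≤ cbrt (Y q) := cbrt_le (by positivity) (hYge q hq)
  have h5 := cbrt_le hk.le (hL q hq)
  have e := cbrt_pow hk.le
  have e8 : cbrt (k / 8) = cbrt k / 2 := by
    rw [cbrt_div hk.le (by norm_num), show (8 : ℝ) = 2 ^ 3 by norm_num, cbrt_of_pow (by norm_num)]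
  rw [e8] at h4
  have hc := cbrt_pos hk
  set c := cbrt k
  have h7 : c ^ 2 / 4 ≤ cbrt (X q) ^ 2 + cbrt (X q) * cbrt (Y q) + cbrt (Y q) ^ 2 := by
    nlinarith
  rw [gapRate, div_div]
  have h8 : k / 4 ≤
      (cbrt (X q) ^ 2 + cbrt (X q) * cbrt (Y q) + cbrt (Y q) ^ 2) * cbrt (lenL w q) :=
    calc k / 4 = (c ^ 2 / 4) * c := by linear_combination -(1 / 4) * e
      _ ≤ _ := mul_le_mul h7 h5 hc.le ((by positivity : (0 : ℝ) ≤ c ^ 2 / 4).trans h7)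
  calc _ ≤ 1 / (k / 4) := one_div_le_one_div_of_le (by positivity) h8
    _ = 4 / k := by field_simp

end IsEvolution

namespace IsEvolution

variable {w₀ : ℝ → ℝ} {w : ℝ → ℝ → ℝ} {β : ℝ → ℝ} {B ε : ℝ} {p m : ℕ}

/-- Clusters of a large multiple of the mean volume have initially been larger, by at least half
the mean residual volume, than those vanishing at present: fewer of them are left. -/
lemma label_add_le (h : IsEvolution w₀ w β B) {t : ℝ} (ht : 0 ≤ t) :
    label w t + 1 / 2 * resid w₀ (label w t) ≤ charTo w (2 * mean w t / fracB B) t 0 := by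
  have hw := h.sol
  have hΛ := hw.mean_pos ht
  have hf := fracB_pos B
  have hp := hw.w₀_label_pos ht
  have hz := hw.label_nonneg ht
  set x := 2 * mean w t / fracB B with hx
  have hx0 : 0 < x := by positivity
  by_contra! hlt
  have hy := (hw.isChar hx0.le ht).nonneg' ⟨le_rfl, ht⟩
  have h1 := h.data.unit.antitone hy (mem_Ici.2 (hy.trans hlt.le)) hlt.le
  rw [← hw.apply_eq hx0.le ht] at h1
  have h2 : fracB B * w₀ (label w t) ≤ _ :=
    h.data.exp_mul_le hz hp (κ := 1 / 2) (by norm_num) (by norm_num)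
  have h3 := (hw.isUnitProfile ht).mul_le_one (x := x) hx0.le
  have h4 := mul_le_mul_of_nonneg_left (h2.trans h1) hx0.le
  have h5 : x * (fracB B * w₀ (label w t)) = 2 := by
    rw [hw.w₀_label' ht, hx]; field_simp
  linarith

/-- In a slow run the labels hardly move on the scale of the mean residual volume. -/
lemma label_bounds_of_slow (h : IsEvolution w₀ w β B) (c : IsThreshold B ε p m) {k : ℕ}
    (hk : IsFast w₀ w ε k)
    (hs : ∀ j, k + 1 ≤ j → j < k + 1 + (p + m) → ¬ IsFast w₀ w ε j) {y : ℝ}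
    (hy : winLabel w (k + 1 + (p + m)) + 1 / 2 * resid w₀ (winLabel w (k + 1 + (p + m))) ≤ y) :
    winLabel w (k + 1 + p) - winLabel w k
        ≤ (1 + 4 * p) * (winLabel w (k + 1) - winLabel w k) ∧
      y - winLabel w (k + 1) ≤ 2 * (y - winLabel w (k + 1 + p)) := by
  have hw := h.sol
  have hε := c.pos
  have hz := hw.winLabel_strictMono (Nat.lt_succ_self k)
  have hma := h.winResid_pos (k + 1)
  have h1 := h.winLabel_sub_le_of_slow hε c.pow_le_two hs p (by omega)
  have h2 := h.winLabel_sub_le_of_slow hε c.pow_le_two hs (p + m) le_rfl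
  have h3 := h.data.resid_le (hw.winLabel_nonneg k) hz.le (hw.w₀_winLabel_pos (k + 1))
  have h4 := h.data.le_resid (hw.winLabel_nonneg (k + 1))
    (hw.winLabel_strictMono.monotone (Nat.le_add_right (k + 1) (p + m)))
    (hw.w₀_winLabel_pos _)
  have h5 := hw.winLabel_strictMono.monotone (show k + 1 + p ≤ k + 1 + (p + m) by omega)
  rw [IsFast] at hk
  have hz' : winLabel w k < winLabel w (k + 1) := hz
  rw [Nat.succ_eq_add_one] at h3
  set d := winLabel w (k + 1) - winLabel w k with hd
  set ma := resid w₀ (winLabel w (k + 1)) with hma'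
  have hd0 : 0 < d := by linarith
  have h6 : ε * ma ≤ 2 * d := by
    have := mul_le_mul_of_nonneg_left h3 hε.le
    have := mul_le_mul_of_nonneg_right c.mul_le hd0.le
    linarith
  have h7 : (p : ℝ) * (2 * ε * ma) ≤ p * (4 * d) :=
    mul_le_mul_of_nonneg_left (by linarith) (Nat.cast_nonneg p)
  have h8 := mul_le_mul_of_nonneg_right c.mul_sum_le hma.le
  constructor <;> linarith

/-- The volumes, at a fast window, of the characteristics vanishing at the start and within a long
slow run, compared with one which survives the run. The one which survives is, in the slow run,
never much larger than the mean. -/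
lemma char_bounds_of_slow (h : IsEvolution w₀ w β B) (c : IsThreshold B ε p m) {k : ℕ}
    (hs : ∀ j, k + 1 ≤ j → j < k + 1 + (p + m) → ¬ IsFast w₀ w ε j) {W : ℝ → ℝ}
    (hW : W = charTo w (2 * winMean w (k + 1 + (p + m)) / fracB B)
      (winTime w (k + 1 + (p + m)))) :
    (W (winTime w k) - charTo w 0 (winTime w (k + 1 + p)) (winTime w k)) * Real.exp (p / 24)
        ≤ 2 * winMean w (k + 1) ∧
      ratioB B * winMean w (k + 1) / 8
        ≤ (W (winTime w k) - charTo w 0 (winTime w (k + 1)) (winTime w k))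
          * Real.exp (1 / ratioB B) := by
  have hw := h.sol
  have hf := fracB_pos B
  have hρ := ratioB_pos B
  have hρ1 := ratioB_le_one h.data.one_le
  have tm := hw.winTime_strictMono
  have t0 := hw.winTime_nonneg
  have hΛ := hw.winMean_pos (k + 1)
  have hΛk := hw.winMean_pos k
  have hΛmono := hw.winMean_mono (Nat.le_succ k)
  have h1p : 1 ≤ p := c.one_le_p
  -- The mean volume is nearly constant in the slow run.
  have hE : (1 : ℝ) ≤ Real.exp (-(B * Real.log (1 - ε))) := by
    have hB := h.data.one_le
    have := Real.log_nonpos (x := 1 - ε) (by linarith [c.lt_one]) (by linarith [c.pos])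
    exact Real.one_le_exp (by nlinarith)
  have hmeanE : winMean w (k + 1 + (p + m)) ≤ 128 / 125 * winMean w (k + 1) :=
    (h.winMean_le_of_slow c.pos c.lt_one hs (p + m) le_rfl).trans
      (mul_le_mul_of_nonneg_right c.pow_le hΛ.le)
  have hmean : ∀ q, 0 ≤ q → q ≤ winTime w (k + 1 + (p + m)) →
      mean w q ≤ 128 / 125 * winMean w (k + 1) := fun q hq0 hq =>
    (hw.mean_mono hq0 hq).trans hmeanE
  set x := 2 * winMean w (k + 1 + (p + m)) / fracB B with hx
  have hx0 : 0 < x := by have := hw.winMean_pos (k + 1 + (p + m)); positivity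
  have hWe : IsChar (lenL w) (winTime w (k + 1 + (p + m))) W := hW ▸ hw.isChar hx0.le (t0 _)
  have hWpos : ∀ s ∈ Icc 0 (winTime w (k + 1 + (p + m))), 0 < W s := fun s hs' =>
    hWe.pos' (by rw [hW, hw.charTo_self hx0.le (t0 _)]; exact hx0) hs'
  have hWr : ∀ n, n ≤ k + 1 + (p + m) → IsChar (lenL w) (winTime w n) W ∧ 0 < W (winTime w n) :=
    fun n hn => ⟨hWe.restrict ⟨t0 n, tm.monotone hn⟩, hWpos _ ⟨t0 n, tm.monotone hn⟩⟩
  have hTa : winTime w (k + 1) = winTime w k + winMean w k / 4 := rfl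
  have hTa1 : winTime w (k + 1 + 1) = winTime w (k + 1) + winMean w (k + 1) / 4 := rfl
  have hTp := hw.mul_le_winTime_sub (k + 1) p
  have hpR : k + 1 + p ≤ k + 1 + (p + m) := by omega
  have hap : winTime w (k + 1) ≤ winTime w (k + 1 + p) := tm.monotone (by omega)
  have hka : winTime w k ≤ winTime w (k + 1) := tm.monotone (by omega)
  -- The surviving characteristic is at most twice the mean.
  have hWle : ∀ q ∈ Icc (winTime w (k + 1)) (winTime w (k + 1 + p)),
      W q ≤ 2 * winMean w (k + 1) := by
    intro q hq
    have hq0 := (t0 (k + 1)).trans hq.1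
    have hqe := hq.2.trans (tm.monotone hpR)
    rw [hW]
    refine h.char_le_two_mul hq0 hqe hx0.le (fun r hr => hmean r (hq0.trans hr.1) hr.2) ?_
    have h1 := hw.mul_le_winTime_sub (k + 1 + p) m
    rw [add_assoc (k + 1) p m] at h1
    have h2 := hw.winMean_mono (Nat.le_add_right (k + 1) p)
    have h3 : 60 / fracB B * winMean w (k + 1) ≤ m * winMean w (k + 1 + p) :=
      mul_le_mul c.le_m h2 hΛ.le (Nat.cast_nonneg m)
    have h4 : x ≤ 256 / 125 / fracB B * winMean w (k + 1) := by
      rw [hx, div_mul_eq_mul_div]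
      exact div_le_div_of_nonneg_right (by linarith) hf.le
    have h5 : 256 / 125 / fracB B * winMean w (k + 1) ≤
        1 / 20 * (60 / fracB B * winMean w (k + 1)) := by
      have : 0 < winMean w (k + 1) / fracB B := by positivity
      calc _ = 256 / 125 * (winMean w (k + 1) / fracB B) := by ring
        _ ≤ 3 * (winMean w (k + 1) / fracB B) := by linarith
        _ = _ := by ring
    linarith [hq.2]
  constructor
  · obtain ⟨hWp, hWp0⟩ := hWr (k + 1 + p) hpR
    have hZ := hw.isChar le_rfl (t0 (k + 1 + p))
    have hZs := hw.charTo_self le_rfl (t0 (k + 1 + p))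
    have hZW : charTo w 0 (winTime w (k + 1 + p)) (winTime w (k + 1 + p))
        < W (winTime w (k + 1 + p)) := by rwa [hZs]
    have g1 := h.gap_contract hΛ (t0 (k + 1)) hap hZ hWp hZW
      (fun q hq => (hmean q ((t0 _).trans hq.1) (hq.2.trans (tm.monotone hpR))).trans
        (by linarith)) hWle
    have g2 := hZ.gap_le_of_le_rate hw.isParam hWp hZW (k := 0) (t0 k) hka hap
      (fun q hq => hZ.gapRate_nonneg hw.isParam hWp ⟨(t0 k).trans hq.1, hq.2.trans hap⟩)
    rw [zero_mul, Real.exp_zero, mul_one] at g2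
    have g3 : (p : ℝ) / 24 ≤
        1 / (6 * winMean w (k + 1)) * (winTime w (k + 1 + p) - winTime w (k + 1)) := by
      rw [one_div_mul_eq_div, le_div_iff₀ (by positivity)]
      linarith
    have g4 := hZ.gap_pos hw.isParam hWp hZW (s := winTime w (k + 1)) ⟨t0 _, hap⟩
    have g5 := hWle _ ⟨hap, le_rfl⟩
    rw [hZs] at g1
    calc _ ≤ (W (winTime w (k + 1)) - charTo w 0 (winTime w (k + 1 + p)) (winTime w (k + 1))) *
          Real.exp (1 / (6 * winMean w (k + 1)) * (winTime w (k + 1 + p) - winTime w (k + 1))) :=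
          mul_le_mul g2 (Real.exp_le_exp.2 g3) (Real.exp_pos _).le (by linarith)
      _ ≤ _ := by linarith
  · obtain ⟨hWa, hWa0⟩ := hWr (k + 1) (by omega)
    obtain ⟨hWa1, hWa10⟩ := hWr (k + 1 + 1) (by omega)
    have hWge : ∀ q ∈ Icc (winTime w k) (winTime w (k + 1)),
        ratioB B * mean w q / 8 ≤ W q := by
      intro q hq
      have hq0 := (t0 k).trans hq.1
      have hq1 : q ≤ winTime w (k + 1 + 1) := by linarith [hq.2]
      refine le_trans ?_ (hw.charTo_zero_lt (t0 _) hWa1 hWa10 ⟨hq0, hq1⟩).le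
      refine le_trans (le_min ?_ le_rfl) (h.min_le_charTo_zero hq0 hq1)
      have h1 : mean w q ≤ winMean w (k + 1) := hw.mean_mono hq0 hq.2
      have h2 := mul_le_mul_of_nonneg_right hρ1 (hw.mean_pos hq0).le
      linarith [hq.2]
    have hY := hw.isChar le_rfl (t0 (k + 1))
    have hYs := hw.charTo_self le_rfl (t0 (k + 1))
    have g1 := h.gap_expand (k := ratioB B * winMean w k) (by positivity) (t0 k) hka hY hWa
      (by rwa [hYs])
      (fun q hq => (mul_le_mul_of_nonneg_left (hw.mean_mono (t0 k) hq.1) hρ.le).trans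
        (h.ratioB_mul_le ((t0 k).trans hq.1)))
      (fun q hq => le_trans (div_le_div_of_nonneg_right
        (mul_le_mul_of_nonneg_left (hw.mean_mono (t0 k) hq.1) hρ.le) (by norm_num)) (hWge q hq))
    have g2 : 4 / (ratioB B * winMean w k) * (winTime w (k + 1) - winTime w k) = 1 / ratioB B := by
      rw [hTa]; field_simp; ring
    rw [g2, hYs, sub_zero] at g1
    exact (hWge _ ⟨hka, le_rfl⟩).trans g1

/-- After a fast window another one follows soon. Otherwise consider the clusters which vanish at
the start of the fast window, at its end, and well within the slow run, together with clusters
surviving the run. The cross-ratio of their initial volumes is bounded below, since the first gap is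
not small against the second. But it decreases in time, and just before the slow run the last gap is
exponentially small. -/
lemma exists_fast (h : IsEvolution w₀ w β B) (c : IsThreshold B ε p m) {k : ℕ}
    (hk : IsFast w₀ w ε k) : ∃ j, k < j ∧ j < k + 1 + (p + m) ∧ IsFast w₀ w ε j := by
  by_contra! hcon
  have hs : ∀ j, k + 1 ≤ j → j < k + 1 + (p + m) → ¬ IsFast w₀ w ε j := fun j h1 h2 =>
    hcon j (by omega) h2
  have hw := h.sol
  have tm := hw.winTime_strictMono
  have t0 := hw.winTime_nonneg
  have h1p : 1 ≤ p := c.one_le_p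
  set W := charTo w (2 * winMean w (k + 1 + (p + m)) / fracB B)
    (winTime w (k + 1 + (p + m))) with hWdef
  have hx0 : 0 < 2 * winMean w (k + 1 + (p + m)) / fracB B := by
    have := hw.winMean_pos (k + 1 + (p + m))
    have := fracB_pos B
    positivity
  have hy := h.label_add_le (t0 (k + 1 + (p + m)))
  have hy' : winLabel w (k + 1 + (p + m)) + 1 / 2 * resid w₀ (winLabel w (k + 1 + (p + m)))
      ≤ W 0 := hy
  obtain ⟨l1, l2⟩ := h.label_bounds_of_slow c hk hs hy'
  obtain ⟨c1, c2⟩ := h.char_bounds_of_slow c hs hWdef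
  have hWe : IsChar (lenL w) (winTime w (k + 1 + (p + m))) W := hw.isChar hx0.le (t0 _)
  have hWpos : 0 < W (winTime w (k + 1 + (p + m))) := by
    rw [hWdef, hw.charTo_self hx0.le (t0 _)]; exact hx0
  have hka : winTime w k < winTime w (k + 1) := tm (by omega)
  have hap : winTime w (k + 1) < winTime w (k + 1 + p) := tm (by omega)
  have hpe : winTime w (k + 1 + p) ≤ winTime w (k + 1 + (p + m)) := tm.monotone (by omega)
  have hke : winTime w k ≤ winTime w (k + 1 + (p + m)) := (hka.trans (hap.trans_le hpe)).le
  have hYk := hw.charTo_zero_pos (t0 k) hka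
  have hYZ := hw.charTo_zero_lt_charTo_zero (t0 k) hka.le hap
  have hZW : charTo w 0 (winTime w (k + 1 + p)) (winTime w k) < W (winTime w k) :=
    hw.charTo_zero_lt (t0 _) (hWe.restrict ⟨t0 _, hpe⟩) (hWe.pos' hWpos ⟨t0 _, hpe⟩)
      ⟨t0 k, (hka.trans hap).le⟩
  have hXs := hw.charTo_self le_rfl (t0 k)
  have key := (hw.isChar le_rfl (t0 k)).cross_ratio hw.isParam
    ((hw.isChar le_rfl (t0 (k + 1))).restrict ⟨t0 k, hka.le⟩)
    ((hw.isChar le_rfl (t0 (k + 1 + p))).restrict ⟨t0 k, (hka.trans hap).le⟩)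
    (hWe.restrict ⟨t0 k, hke⟩) (by rwa [hXs]) hYZ hZW (t0 k)
  rw [hXs, sub_zero, sub_zero] at key
  have eX : charTo w 0 (winTime w k) 0 = winLabel w k := rfl
  have eY : charTo w 0 (winTime w (k + 1)) 0 = winLabel w (k + 1) := rfl
  have eZ : charTo w 0 (winTime w (k + 1 + p)) 0 = winLabel w (k + 1 + p) := rfl
  rw [eX, eY, eZ] at key
  have z1 : winLabel w k < winLabel w (k + 1) := hw.winLabel_strictMono (by omega)
  have z2 : winLabel w (k + 1) < winLabel w (k + 1 + p) := hw.winLabel_strictMono (by omega)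
  have hΛ := hw.winMean_pos (k + 1)
  have hρ := ratioB_pos B
  have hcon := c.contraction
  have hE1 := Real.exp_pos (1 / ratioB B)
  have hE2 := Real.exp_pos ((p : ℝ) / 24)
  set Yk := charTo w 0 (winTime w (k + 1)) (winTime w k)
  set Zk := charTo w 0 (winTime w (k + 1 + p)) (winTime w k)
  set Wk := W (winTime w k)
  set d := winLabel w (k + 1) - winLabel w k
  set g := W 0 - winLabel w (k + 1 + p)
  have hd : 0 < d := sub_pos.2 z1
  have hg : 0 < g := by linarith
  have hWZ : 0 < Wk - Zk := sub_pos.2 hZW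
  have k1 : d * g * (Zk * (Wk - Yk)) ≤ d * g * (2 * (1 + 4 * p) * (Zk * (Wk - Zk))) := by
    refine key.trans ?_
    have a1 := mul_le_mul l1 l2 (by linarith) (by positivity)
    have a2 : Yk * (Wk - Zk) ≤ Zk * (Wk - Zk) := mul_le_mul_of_nonneg_right hYZ.le hWZ.le
    calc _ ≤ ((1 + 4 * p) * d * (2 * g)) * (Zk * (Wk - Zk)) :=
          mul_le_mul a1 a2 (by positivity) (by positivity)
      _ = _ := by ring
  have k2 : Wk - Yk ≤ 2 * (1 + 4 * p) * (Wk - Zk) := by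
    have := le_of_mul_le_mul_left k1 (by positivity)
    refine le_of_mul_le_mul_left ?_ (hYk.trans hYZ)
    linarith
  have k3 := mul_le_mul_of_nonneg_right k2 hE1.le
  have k4 : ratioB B * winMean w (k + 1) / 8 * Real.exp (p / 24)
      ≤ 2 * (1 + 4 * p) * Real.exp (1 / ratioB B) * (2 * winMean w (k + 1)) := by
    calc _ ≤ 2 * (1 + 4 * p) * (Wk - Zk) * Real.exp (1 / ratioB B) * Real.exp (p / 24) :=
          mul_le_mul_of_nonneg_right (c2.trans k3) hE2.le
      _ = 2 * (1 + 4 * p) * Real.exp (1 / ratioB B) * ((Wk - Zk) * Real.exp (p / 24)) := by ring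
      _ ≤ _ := mul_le_mul_of_nonneg_left c1 (by positivity)
  have k5 := mul_lt_mul_of_pos_right hcon hΛ
  linarith

end IsEvolution

/-! ### Growth of the mean volume -/

namespace IsSolution

variable {w₀ : ℝ → ℝ} {w : ℝ → ℝ → ℝ}

lemma winTime_sub_le (hw : IsSolution w₀ w) (a : ℕ) :
    ∀ i : ℕ, winTime w (a + i) - winTime w a ≤ i * winMean w (a + i) / 4
  | 0 => by simp
  | i + 1 => by
    have h1 := hw.winTime_sub_le a i
    have h2 := hw.winMean_mono (show a + i ≤ a + (i + 1) by omega)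
    have h3 : winTime w (a + (i + 1)) = winTime w (a + i) + winMean w (a + i) / 4 := rfl
    have h4 := mul_le_mul_of_nonneg_left h2 (Nat.cast_nonneg (α := ℝ) i)
    push_cast
    linarith

/-- Every time lies in a window. -/
lemma exists_window (hw : IsSolution w₀ w) {T : ℝ} (hT : 0 ≤ T) :
    ∃ n, winTime w n ≤ T ∧ T < winTime w (n + 1) := by
  have hex : ∃ n, T < winTime w n := by
    have hΛ := hw.winMean_pos 0
    obtain ⟨n, hn⟩ := exists_nat_gt (T / (winMean w 0 / 4))
    rw [div_lt_iff₀ (by positivity)] at hn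
    refine ⟨n, ?_⟩
    have h1 := hw.mul_le_winTime_sub 0 n
    have h2 : winTime w 0 = 0 := rfl
    rw [zero_add, h2] at h1
    linarith
  classical
  have h0 : Nat.find hex ≠ 0 := fun h => by
    have := Nat.find_spec hex
    rw [h] at this
    exact absurd this (not_lt.2 hT)
  obtain ⟨n, hn⟩ := Nat.exists_eq_succ_of_ne_zero h0
  refine ⟨n, not_lt.1 (Nat.find_min hex (by omega)), ?_⟩
  have := Nat.find_spec hex
  rwa [hn] at this

end IsSolution

namespace IsEvolution

variable {w₀ : ℝ → ℝ} {w : ℝ → ℝ → ℝ} {β : ℝ → ℝ} {B ε b y₀ μ : ℝ} {p m : ℕ}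

/-- Among any `p + m + 1` consecutive windows there is a fast one. -/
lemma exists_fast_between (h : IsEvolution w₀ w β B) (c : IsThreshold B ε p m) (i : ℕ) :
    ∃ k, i ≤ k ∧ k < i + (p + m + 1) ∧ IsFast w₀ w ε k := by
  induction i with
  | zero => exact ⟨0, le_rfl, by omega, h.isFast_zero c⟩
  | succ i ih =>
    obtain ⟨k, h1, h2, hk⟩ := ih
    rcases h1.eq_or_lt with rfl | h1
    · obtain ⟨j, h3, h4, hj⟩ := h.exists_fast c hk
      exact ⟨j, h3, by omega, hj⟩
    · exact ⟨k, h1, by omega, hk⟩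

/-- Where `β` is bounded below, a fast window increases the mean volume by a factor. -/
lemma exp_mul_winMean_le (h : IsEvolution w₀ w β B) (hε : 0 < ε) (hε1 : ε < 1)
    (hβ : ∀ y, y₀ ≤ y → 0 < y → 0 < w₀ y → b ≤ β y) {k : ℕ} (hk : IsFast w₀ w ε k)
    (hy : y₀ ≤ winLabel w k) :
    Real.exp (b * ε / (1 + B * ε)) * winMean w k ≤ winMean w (k + 1) := by
  have hw := h.sol
  have hz := hw.winLabel_nonneg k
  have hr := h.winResid_pos k
  have h1 := h.data.le_exp_mul hz (hw.w₀_winLabel_pos k) hε.le hε1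
    (fun x hx h1 h2 => hβ x (hy.trans hx) h1 h2)
  rw [IsFast] at hk
  have h2 := h.data.unit.antitone (show 0 ≤ winLabel w k + ε * resid w₀ (winLabel w k) by positivity)
    (mem_Ici.2 (hw.winLabel_nonneg (k + 1)))
    (show winLabel w k + ε * resid w₀ (winLabel w k) ≤ winLabel w (k + 1) by linarith)
  have h3 := h2.trans h1
  rw [hw.w₀_winLabel, hw.w₀_winLabel, mul_one_div, Real.exp_neg,
    div_le_div_iff₀ (hw.winMean_pos _) (hw.winMean_pos _), one_mul, inv_mul_eq_div,
    le_div_iff₀ (Real.exp_pos _)] at h3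
  linarith

/-- The labels exceed `y₀` after a bounded number of windows. -/
lemma min_le_winLabel (h : IsEvolution w₀ w β B) (c : IsThreshold B ε p m) (hμ : 0 < μ)
    (hr : ∀ y, 0 ≤ y → y ≤ y₀ → 0 < w₀ y → μ ≤ resid w₀ y) (i : ℕ) :
    min y₀ (i * (ε * μ)) ≤ winLabel w (i * (p + m + 1)) := by
  have hw := h.sol
  induction i with
  | zero => exact (min_le_right _ _).trans (by simpa using hw.winLabel_nonneg 0)
  | succ i ih =>
    obtain ⟨k, h1, h2, hk⟩ := h.exists_fast_between c (i * (p + m + 1))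
    have h3 := hw.winLabel_strictMono.monotone h1
    have h4 := hw.winLabel_strictMono.monotone
      (show k + 1 ≤ (i + 1) * (p + m + 1) by rw [add_one_mul]; omega)
    have h5 := hw.winLabel_strictMono.monotone (Nat.le_succ k)
    rw [Nat.succ_eq_add_one] at h5
    rcases le_total y₀ (winLabel w k) with hy | hy
    · exact (min_le_left _ _).trans (hy.trans (h5.trans h4))
    · rw [IsFast] at hk
      have h6 := mul_le_mul_of_nonneg_left
        (hr _ (hw.winLabel_nonneg k) hy (hw.w₀_winLabel_pos k)) c.pos.le
      have h7 : 0 ≤ ε * μ := mul_nonneg c.pos.le hμ.le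
      push_cast
      rcases min_le_iff.1 ih with h8 | h8
      · exact (min_le_left _ _).trans (by linarith)
      · exact (min_le_right _ _).trans (by linarith)

/-- If the mean volume eventually grows by a fixed factor in a fixed number of windows, then the
time is bounded by a multiple of the mean volume, as for a geometric sum. -/
lemma winTime_le_mul (h : IsEvolution w₀ w β B) {q : ℝ} (hq1 : q < 1) {N M : ℕ}
    (hM : 0 < M) (hg : ∀ n, N ≤ n → winMean w n ≤ q * winMean w (n + M)) (n : ℕ) :
    winTime w n ≤ (((N + M : ℕ) : ℝ) / 4 + M / (4 * (1 - q))) * winMean w n := by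
  have hw := h.sol
  have h1q : 0 < 1 - q := by linarith
  induction n using Nat.strong_induction_on with
  | _ n ih =>
    have hΛ := hw.winMean_pos n
    rcases lt_or_ge n (N + M) with hn | hn
    · have h1 := hw.winTime_sub_le 0 n
      have h2 : winTime w 0 = 0 := rfl
      rw [zero_add, h2, sub_zero] at h1
      have h3 : (n : ℝ) * winMean w n ≤ ((N + M : ℕ) : ℝ) * winMean w n :=
        mul_le_mul_of_nonneg_right (by exact_mod_cast hn.le) hΛ.le
      have h4 : 0 ≤ (M / (4 * (1 - q)) : ℝ) * winMean w n := by positivity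
      linarith
    · obtain ⟨k, rfl⟩ := Nat.exists_eq_add_of_le' (show M ≤ n by omega)
      have h1 := ih k (by omega)
      have h2 := hw.winTime_sub_le k M
      have h3 := hg k (by omega)
      set A := ((N + M : ℕ) : ℝ) / 4 + M / (4 * (1 - q)) with hA
      have hA0 : 0 ≤ A := by positivity
      have h4 := mul_le_mul_of_nonneg_left h3 hA0
      have h5 : (M : ℝ) / 4 ≤ A * (1 - q) := by
        have e : (M / (4 * (1 - q)) : ℝ) * (1 - q) = M / 4 := by field_simp
        rw [hA, add_mul, e]
        have : 0 ≤ ((N + M : ℕ) : ℝ) / 4 * (1 - q) := by positivity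
        linarith
      have h6 := mul_le_mul_of_nonneg_right h5 hΛ.le
      linarith

end IsEvolution

/-- The lower bound for the mean volume, with a constant depending only on bounds for `β`, the
volume `y₀` beyond which `β` is bounded below, and a lower bound for the mean residual volume up to
`y₀`. -/
lemma exists_growth (β : ℝ → ℝ) {B b μ : ℝ} (y₀ : ℝ) (hB : 0 ≤ B) (hb : 0 < b) (hμ : 0 < μ) :
    ∃ C, 0 < C ∧ ∀ w₀ w, IsEvolution w₀ w β B →
      (∀ y, y₀ ≤ y → 0 < y → 0 < w₀ y → b ≤ β y) →
      (∀ y, 0 ≤ y → y ≤ y₀ → 0 < w₀ y → μ ≤ resid w₀ y) →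
      ∀ T, 0 ≤ T → C * T ≤ mean w T := by
  obtain ⟨ε, p, m, c⟩ := exists_isThreshold B
  have hε := c.pos
  obtain ⟨K, hK⟩ := exists_nat_ge (y₀ / (ε * μ))
  rw [div_le_iff₀ (by positivity)] at hK
  set M := p + m + 1 with hM
  set η := b * ε / (1 + B * ε) with hη
  have hη0 : 0 < η := by positivity
  have hq1 : Real.exp (-η) < 1 := Real.exp_lt_one_iff.2 (by linarith)
  have h1q : 0 < 1 - Real.exp (-η) := by linarith
  set A := ((K * M + M : ℕ) : ℝ) / 4 + M / (4 * (1 - Real.exp (-η))) with hA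
  have hA0 : 0 ≤ A := by positivity
  refine ⟨1 / (A + 1 / 4), by positivity, fun w₀ w h hβ hr T hT => ?_⟩
  have hw := h.sol
  have hlab : ∀ n, K * M ≤ n → y₀ ≤ winLabel w n := fun n hn => by
    have := h.min_le_winLabel c hμ hr K
    rw [min_eq_left hK] at this
    exact this.trans (hw.winLabel_strictMono.monotone hn)
  have hg : ∀ n, K * M ≤ n → winMean w n ≤ Real.exp (-η) * winMean w (n + M) := fun n hn => by
    obtain ⟨k, h1, h2, hk⟩ := h.exists_fast_between c n
    have h3 := h.exp_mul_winMean_le hε c.lt_one hβ hk (hlab k (hn.trans h1))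
    have h4 := hw.winMean_mono h1
    have h5 := hw.winMean_mono (show k + 1 ≤ n + M by omega)
    rw [Real.exp_neg, inv_mul_eq_div, le_div_iff₀ (Real.exp_pos _)]
    have h6 := mul_le_mul_of_nonneg_right h4 (Real.exp_pos η).le
    linarith
  obtain ⟨n, hn1, hn2⟩ := hw.exists_window hT
  have h1 := h.winTime_le_mul hq1 (show 0 < M by omega) hg n
  rw [← hA] at h1
  have h2 : winMean w n ≤ mean w T := hw.mean_mono (hw.winTime_nonneg n) hn1
  rw [IsSolution.winTime_succ] at hn2
  have h3 := mul_le_mul_of_nonneg_left h2 (show 0 ≤ A + 1 / 4 by positivity)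
  rw [one_div_mul_eq_div, div_le_iff₀ (by positivity)]
  linarith

/-! ### The initial datum is essentially determined by its beta function -/

namespace HasBeta

variable {u v β : ℝ → ℝ} {B : ℝ}

lemma resid_zero (h : HasBeta u β B) : resid u 0 = 1 / u 0 := by
  have : tailIntegral u 0 = 1 := h.unit.mass
  rw [resid, this]

/-- Mean residual volumes with the same beta function differ by a constant. -/
lemma resid_sub_eq (hu : HasBeta u β B) (hv : HasBeta v β B)
    (hs : ∀ y, 0 ≤ y → (0 < u y ↔ 0 < v y)) {y : ℝ} (hy : 0 ≤ y) (hp : 0 < u y) :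
    resid v y - resid u y = resid v 0 - resid u 0 := by
  have cu := hu.continuousOn_resid_Icc le_rfl hp
  have cv := hv.continuousOn_resid_Icc le_rfl ((hs y hy).1 hp)
  have h1 := hu.le_of_deriv_nonneg (f := fun x => resid v x - resid u x) (f' := fun _ => 0)
    le_rfl hy hp (cv.sub cu)
    (fun x hx _ _ hpx => ((hv.hasDerivAt_resid hx ((hs x hx.le).1 hpx)).sub
      (hu.hasDerivAt_resid hx hpx)).congr_deriv (by ring)) (fun _ _ _ _ _ => le_rfl)
  have h2 := hu.le_of_deriv_nonneg (f := fun x => resid u x - resid v x) (f' := fun _ => 0)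
    le_rfl hy hp (cu.sub cv)
    (fun x hx _ _ hpx => ((hu.hasDerivAt_resid hx hpx).sub
      (hv.hasDerivAt_resid hx ((hs x hx.le).1 hpx))).congr_deriv (by ring))
    (fun _ _ _ _ _ => le_rfl)
  linarith

/-- If the mean residual volume of `v` exceeds that of `u`, then `v` decays more slowly. -/
lemma mul_le_mul_of_resid_le (hu : HasBeta u β B) (hv : HasBeta v β B)
    (hs : ∀ y, 0 ≤ y → (0 < u y ↔ 0 < v y)) (h0 : resid u 0 ≤ resid v 0) {y : ℝ} (hy : 0 ≤ y) :
    v 0 * u y ≤ u 0 * v y := by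
  rcases (hu.unit.nonneg y hy).eq_or_lt with hp | hp
  · rw [← hp, mul_zero]
    exact mul_nonneg (hu.unit.nonneg 0 le_rfl) (hv.unit.nonneg y hy)
  have hvp := (hs y hy).1 hp
  have hlog : ∀ {f : ℝ → ℝ}, HasBeta f β B → 0 < f y →
      ContinuousOn (fun x => Real.log (f x)) (Icc 0 y) := fun hf hfy =>
    ContinuousOn.log (hf.continuousOn.mono Icc_subset_Ici_self) fun x hx =>
      (hf.pos_of_le hx.1 hx.2 hfy).ne'
  have h1 := hu.le_of_deriv_nonneg (f := fun x => Real.log (v x) - Real.log (u x))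
    (f' := fun x => β x / resid u x - β x / resid v x) le_rfl hy hp
    ((hlog hv hvp).sub (hlog hu hp))
    (fun x hx _ _ hpx => by
      have hvx := (hs x hx.le).1 hpx
      refine (((hv.hasDerivAt x hx hvx).log hvx.ne').sub
        ((hu.hasDerivAt x hx hpx).log hpx.ne')).congr_deriv ?_
      field_simp
      ring)
    (fun x hx _ _ hpx => by
      have hr := hu.resid_sub_eq hv hs hx.le hpx
      exact sub_nonneg.2 (div_le_div_of_nonneg_left (hu.beta_nonneg x hx hpx)
        (hu.resid_pos hx.le hpx) (by linarith)))
  have hu0 := hu.unit.zero_pos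
  have hv0 := hv.unit.zero_pos
  have h2 : Real.log (v 0 * u y) ≤ Real.log (u 0 * v y) := by
    rw [Real.log_mul hv0.ne' hp.ne', Real.log_mul hu0.ne' hvp.ne']
    linarith
  exact (Real.log_le_log_iff (by positivity) (by positivity)).1 h2

/-- Of two data with the same beta function and `L = 1`, neither decays strictly more slowly, since
`L = 1` prescribes the integral of `x^{-2/3} u x / u 0`. -/
lemma zero_eq_of_resid_le (hu : HasBeta u β B) (hv : HasBeta v β B)
    (hs : ∀ y, 0 ≤ y → (0 < u y ↔ 0 < v y)) (h0 : resid u 0 ≤ resid v 0) (hLu : paramL u = 1)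
    (hLv : paramL v = 1) : u 0 = v 0 := by
  have hint : ∀ {f : ℝ → ℝ}, IsUnitProfile f → paramL f = 1 →
      ∫ x in Ioi (0 : ℝ), x ^ (-(2 / 3) : ℝ) * f x = 3 * f 0 := fun {f} hf hL => by
    have h1 : rootL f = 1 := by
      rw [paramL_eq] at hL
      exact (pow_eq_one_iff_of_nonneg hf.rootL_pos.le (by norm_num)).1 hL
    rw [rootL, div_eq_one_iff_eq hf.zero_pos.ne'] at h1
    linarith
  set g : ℝ → ℝ := fun x => u 0 * (x ^ (-(2 / 3) : ℝ) * v x) - v 0 * (x ^ (-(2 / 3) : ℝ) * u x)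
    with hg
  have iu := hu.unit.integrable_singular.const_mul (v 0)
  have iv := hv.unit.integrable_singular.const_mul (u 0)
  have hgint : ∫ x in Ioi (0 : ℝ), g x = 0 := by
    rw [hg, integral_sub iv iu, integral_const_mul, integral_const_mul, hint hu.unit hLu,
      hint hv.unit hLv]
    ring
  have hgnn : 0 ≤ᵐ[volume.restrict (Ioi (0 : ℝ))] g := by
    filter_upwards [self_mem_ae_restrict measurableSet_Ioi] with x hx
    have hx : 0 < x := hx
    have h1 := mul_le_mul_of_nonneg_left (hu.mul_le_mul_of_resid_le hv hs h0 hx.le)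
      (Real.rpow_nonneg hx.le (-(2 / 3) : ℝ))
    simp only [hg, Pi.zero_apply]
    linarith
  have hae := (integral_eq_zero_iff_of_nonneg_ae hgnn (iv.sub iu)).1 hgint
  have heq : ∫ x in Ioi (0 : ℝ), u 0 * v x = ∫ x in Ioi (0 : ℝ), v 0 * u x := by
    refine integral_congr_ae ?_
    filter_upwards [hae, self_mem_ae_restrict measurableSet_Ioi] with x hx hx0
    have hx0 : 0 < x := hx0
    refine mul_left_cancel₀ (Real.rpow_pos_of_pos hx0 (-(2 / 3) : ℝ)).ne' ?_
    simp only [hg, Pi.zero_apply] at hx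
    linarith
  rwa [integral_const_mul, integral_const_mul, hu.unit.mass, hv.unit.mass, mul_one, mul_one] at heq

/-- The beta function, together with the normalizations of mass and of `L`, determines the mean
residual volume. -/
lemma resid_eq (hu : HasBeta u β B) (hv : HasBeta v β B)
    (hs : ∀ y, 0 ≤ y → (0 < u y ↔ 0 < v y)) (hLu : paramL u = 1) (hLv : paramL v = 1) {y : ℝ}
    (hy : 0 ≤ y) (hp : 0 < u y) : resid v y = resid u y := by
  have h0 : u 0 = v 0 := by
    rcases le_total (resid u 0) (resid v 0) with h | h
    · exact hu.zero_eq_of_resid_le hv hs h hLu hLv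
    · exact (hv.zero_eq_of_resid_le hu (fun y hy => (hs y hy).symm) h hLv hLu).symm
  have h1 := hu.resid_sub_eq hv hs hy hp
  rw [hu.resid_zero, hv.resid_zero, h0, sub_self] at h1
  linarith

end HasBeta

/-! ### The behaviour at the end of the support -/

/-- A function with limit `b > 0` at the end `a` is at least `b / 2` near that end. -/
lemma exists_forall_half_le {a : EReal} {β : ℝ → ℝ} {b : ℝ} (ha : 0 < a) (hb : 0 < b)
    (hlim : Tendsto β (towardsEnd a) (𝓝 b)) :
    ∃ y₀ : ℝ, 0 ≤ y₀ ∧ (y₀ : EReal) < a ∧ ∀ y : ℝ, y₀ ≤ y → (y : EReal) < a → b / 2 ≤ β y := by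
  have h1 : ∀ᶠ y in towardsEnd a, b / 2 < β y := hlim.eventually_const_lt (by linarith)
  obtain ⟨s, hs, hsub⟩ := mem_comap.1 h1
  obtain ⟨l, hl, hIoo⟩ := (mem_nhdsLT_iff_exists_Ioo_subset' ha).1 hs
  obtain ⟨y₀, h2, h3⟩ := EReal.lt_iff_exists_real_btwn.1 (max_lt ha hl)
  refine ⟨y₀, EReal.coe_le_coe_iff.1 ((le_max_left _ _).trans h2.le), h3, fun y hy hya => ?_⟩
  exact le_of_lt (hsub (hIoo ⟨((le_max_right _ _).trans_lt h2).trans_le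
    (EReal.coe_le_coe_iff.2 hy), hya⟩))

lemma IsSolution.isUnitProfile_initial {w₀ : ℝ → ℝ} {w : ℝ → ℝ → ℝ} (hw : IsSolution w₀ w)
    (h : IsInitialDatum w₀) : IsUnitProfile w₀ where
  nonneg := h.nonneg
  antitone := h.antitone
  integrable := h.integrable
  mass := by
    rw [← hw.conservation 0 le_rfl]
    exact setIntegral_congr_fun measurableSet_Ioi fun x hx => (hw.initial x (le_of_lt hx)).symm

lemma IsSolution.continuousOn_initial {w₀ : ℝ → ℝ} {w : ℝ → ℝ → ℝ} (hw : IsSolution w₀ w) :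
    ContinuousOn w₀ (Ici 0) :=
  (hw.continuousOn_space le_rfl).congr fun x hx => (hw.initial x hx).symm

lemma IsSolution.hasBeta {w₀ : ℝ → ℝ} {w : ℝ → ℝ → ℝ} (hw : IsSolution w₀ w)
    (h : IsInitialDatum w₀) {β : ℝ → ℝ} {B : ℝ} (hB : 1 ≤ B)
    (hβ : EqOn (betaFun w₀) β (domainUpTo (supportEnd w₀)))
    (hle : ∀ y ∈ domainUpTo (supportEnd w₀), β y ≤ B) : HasBeta w₀ β B :=
  h.hasBeta (hw.isUnitProfile_initial h) hw.continuousOn_initial hB hβ hle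

end LSW

end

theorem proposition5p2 (a : EReal) (β₀ : ℝ → ℝ)
    (hsup : BddAbove (β₀ '' LSW.domainUpTo a))
    (hlim : ∃ b : ℝ, 0 < b ∧ Tendsto β₀ (LSW.towardsEnd a) (𝓝 b)) :
    ∃ C : ℝ, 0 < C ∧
      ∀ w₀ : ℝ → ℝ, LSW.IsInitialDatum w₀ → LSW.paramL w₀ = 1 →
        LSW.supportEnd w₀ = a → EqOn (LSW.betaFun w₀) β₀ (LSW.domainUpTo a) →
        ∀ w : ℝ → ℝ → ℝ, LSW.IsSolution w₀ w →
          ∀ T : ℝ, 1 ≤ T → C * T ≤ LSW.meanVolume w T := by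
  by_cases hex : ∃ u v, LSW.IsInitialDatum u ∧ LSW.paramL u = 1 ∧ LSW.supportEnd u = a ∧
      EqOn (LSW.betaFun u) β₀ (LSW.domainUpTo a) ∧ LSW.IsSolution u v
  swap
  · exact ⟨1, one_pos, fun u h1 h2 h3 h4 v h5 => absurd ⟨u, v, h1, h2, h3, h4, h5⟩ hex⟩
  -- The constant may refer to one of the solutions, as its initial mean residual volume is a
  -- function of `β₀` by uniqueness.
  obtain ⟨u, v, hu, hLu, hau, hβu, hv⟩ := hex
  obtain ⟨B', hB'⟩ := hsup
  obtain ⟨b, hb, hlim⟩ := hlim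
  have hle : ∀ y ∈ LSW.domainUpTo a, β₀ y ≤ max 1 B' := fun y hy =>
    (hB' (mem_image_of_mem β₀ hy)).trans (le_max_right _ _)
  have hmem : ∀ {w₀ w}, LSW.IsInitialDatum w₀ → LSW.supportEnd w₀ = a → LSW.IsSolution w₀ w →
      ∀ y, y ∈ LSW.domainUpTo a ↔ 0 ≤ y ∧ 0 < w₀ y := fun {w₀ w} h ha hw y => by
    rw [← ha]
    exact LSW.mem_domainUpTo_iff (hw.isUnitProfile_initial h) hw.continuousOn_initial
  have hU : LSW.HasBeta u β₀ (max 1 B') := by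
    subst hau
    exact hv.hasBeta hu (le_max_left _ _) hβu hle
  have ha : 0 < a := ((hmem hu hau hv 0).2 ⟨le_rfl, hU.unit.zero_pos⟩).2
  obtain ⟨y₀, hy0, hya, hβ⟩ := LSW.exists_forall_half_le ha hb hlim
  have huy := ((hmem hu hau hv y₀).1 ⟨hy0, hya⟩).2
  obtain ⟨x, hx, hmin⟩ := isCompact_Icc.exists_isMinOn (nonempty_Icc.2 hy0)
    (hU.continuousOn_resid_Icc le_rfl huy)
  have hxp := hU.pos_of_le hx.1 hx.2 huy
  obtain ⟨C, hC, hgrow⟩ := LSW.exists_growth β₀ y₀ (B := max 1 B') (by positivity)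
    (half_pos hb) (hU.resid_pos hx.1 hxp)
  refine ⟨C, hC, fun w₀ h₀ hL ha₀ hβ₀ w hw T hT => ?_⟩
  have hW : LSW.HasBeta w₀ β₀ (max 1 B') := by
    subst ha₀
    exact hw.hasBeta h₀ (le_max_left _ _) hβ₀ hle
  have hs : ∀ y, 0 ≤ y → (0 < u y ↔ 0 < w₀ y) := fun y hy => by
    have h1 := hmem hu hau hv y
    have h2 := hmem h₀ ha₀ hw y
    rw [h1] at h2
    exact ⟨fun h => (h2.1 ⟨hy, h⟩).2, fun h => (h2.2 ⟨hy, h⟩).2⟩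
  rw [hw.meanVolume_eq (by linarith)]
  refine hgrow w₀ w ⟨hw, hW⟩ (fun y h1 h2 h3 => ?_) (fun y h1 h2 h3 => ?_) T (by linarith)
  · exact hβ y h1 ((hmem h₀ ha₀ hw y).2 ⟨h2.le, h3⟩).2
  · rw [hU.resid_eq hW hs hLu hL h1 ((hs y h1).2 h3)]
    exact hmin ⟨h1, h2⟩
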